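/- Let $G$ be a Lie group acting smoothly and transitively on a smooth manifold $M$, let $H$ be the isotropy subgroup of a point $p\in M$, so that $M=G/H$, and let $\mathfrak g,\mathfrak h$ be the Lie algebras of $G,H$. Let $F$ be a $G$-invariant Randers metric on $M$, that is, a $G$-invariant Finsler metric of the form $F(x,y)=\sqrt{\tilde a_x(y,y)}+\tilde a_x(X,y)$ with $\tilde a$ a Riemannian metric and $X$ a smooth vector field on $M$ such that $\tilde a(X,X)<1$ everywhere. Assume that $F$ is of Berwald type: in natural coordinates the Chern connection coefficients $\Gamma^i_{jk}(x,y)$ of $F$ do not depend on $y\neq0$. Then the homogeneous space $(G/H,F)$ is naturally reductive if and only if $(G/H,\tilde a)$ is naturally reductive. Here a reductive decomposition is a vector space decomposition $\mathfrak g=\mathfrak m\oplus\mathfrak h$ with $\mathrm{Ad}(H)\mathfrak m\subseteq\mathfrak m$; it identifies $\mathfrak m$ with $T_pM$ through the differential of $g\mapsto g\cdot p$, and $Z_{\mathfrak m}$ denotes the $\mathfrak m$-component of $Z\in\mathfrak g$. A $G$-invariant Riemannian metric on $M$ is naturally reductive if there is a reductive decomposition such that, for the induced inner product on $\mathfrak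 m$, $$\langle [x,y]_{\mathfrak m},z\rangle+\langle y,[x,z]_{\mathfrak m}\rangle=0\qquad\text{for all }x,y,z\in\mathfrak m .$$ A $G$-invariant Finsler metric $F$ on $M$ is naturally reductive if there is a reductive decomposition such that, for the Minkowski norm on $\mathfrak m$ induced by $F$, $$g_y([x,u]_{\mathfrak m},v)+g_y(u,[x,v]_{\mathfrak m})+2C_y([x,y]_{\mathfrak m},u,v)=0\qquad\text{for all }x,y,u,v\in\mathfrak m,\ y\ne0,$$ where $g_y(u,v)=\tfrac12\left.\frac{\partial^2}{\partial s\,\partial t}F^2(y+su+tv)\right|_{s=t=0}$ is the fundamental tensor and $C_y(z,u,v)=\tfrac12\left.\frac{d}{dt}g_{y+tv}(z,u)\right|_{t=0}$ the Cartan tensor. That $\tilde a$ is $G$-invariant is part of the conclusion and not an assumption. -/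

import Mathlib

open scoped Manifold ContDiff Bundle

noncomputable section

namespace HomFinsler

/-! ### Minkowski norms on a real vector space -/

section Minkowski

variable {V : Type*} [AddCommGroup V] [Module ℝ V]

/-- The fundamental tensor `g_y(u, v) = ½ ∂²/∂s∂t N²(y + s u + t v)` at `s = t = 0` of a function
`N` on a vector space. -/
def fundamentalTensor (N : V → ℝ) (y u v : V) : ℝ :=
  (1 / 2) * deriv (fun s : ℝ => deriv (fun t : ℝ => N (y + s • u + t • v) ^ 2) 0) 0

/-- The Cartan tensor `C_y(z, u, v) = ½ d/dt g_{y + t v}(z, u)` at `t = 0`. -/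
def cartanTensor (N : V → ℝ) (y z u v : V) : ℝ :=
  (1 / 2) * deriv (fun t : ℝ => fundamentalTensor N (y + t • v) z u) 0

end Minkowski

/-! ### The Chern connection coefficients in coordinates

Here `L ξ η` is a Finsler function written in natural coordinates: `ξ` is the position and `η` the
velocity. -/

section Coordinates

variable {n : ℕ}

/-- The coordinate vector `∂/∂x^i`. -/
abbrev coordVec (i : Fin n) : EuclideanSpace ℝ (Fin n) := EuclideanSpace.single i 1

variable (L : EuclideanSpace ℝ (Fin n) → EuclideanSpace ℝ (Fin n) → ℝ)

/-- The matrix `g_ij(x, y) = (½ L²)_{y^i y^j}`. -/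
def metricMatrix (ξ η : EuclideanSpace ℝ (Fin n)) : Matrix (Fin n) (Fin n) ℝ :=
  Matrix.of fun i j => fundamentalTensor (L ξ) η (coordVec i) (coordVec j)

/-- The partial derivative `∂g_ij / ∂x^k`. -/
def metricDx (ξ η : EuclideanSpace ℝ (Fin n)) (i j k : Fin n) : ℝ :=
  lineDeriv ℝ (fun ξ' => metricMatrix L ξ' η i j) ξ (coordVec k)

/-- The partial derivative `∂g_ij / ∂y^k`. -/
def metricDy (ξ η : EuclideanSpace ℝ (Fin n)) (i j k : Fin n) : ℝ :=
  lineDeriv ℝ (fun η' => metricMatrix L ξ η' i j) η (coordVec k)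

/-- The geodesic spray coefficients
`G^j = ¼ g^{jl} (2 ∂g_sl/∂x^k - ∂g_sk/∂x^l) y^s y^k`. -/
def sprayCoeff (ξ η : EuclideanSpace ℝ (Fin n)) (j : Fin n) : ℝ :=
  (1 / 4) * ∑ l, ∑ s, ∑ k, (metricMatrix L ξ η)⁻¹ j l *
    (2 * metricDx L ξ η s l k - metricDx L ξ η s k l) * η s * η k

/-- The nonlinear connection `N^i_j = ∂G^i / ∂y^j`. -/
def nonlinearConnection (ξ η : EuclideanSpace ℝ (Fin n)) (i j : Fin n) : ℝ :=
  lineDeriv ℝ (fun η' => sprayCoeff L ξ η' i) η (coordVec j)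

/-- The horizontal derivative `δg_ij/δx^k = ∂g_ij/∂x^k - N^m_k ∂g_ij/∂y^m`. -/
def metricHorizontal (ξ η : EuclideanSpace ℝ (Fin n)) (i j k : Fin n) : ℝ :=
  metricDx L ξ η i j k - ∑ m, nonlinearConnection L ξ η m k * metricDy L ξ η i j m

/-- The Chern connection coefficients
`Γ^i_jk = ½ g^{il} (δg_lk/δx^j + δg_lj/δx^k - δg_jk/δx^l)`. -/
def chernCoeff (ξ η : EuclideanSpace ℝ (Fin n)) (i j k : Fin n) : ℝ :=
  (1 / 2) * ∑ l, (metricMatrix L ξ η)⁻¹ i l *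
    (metricHorizontal L ξ η l k j + metricHorizontal L ξ η l j k - metricHorizontal L ξ η j k l)

end Coordinates

/-! ### Finsler metrics, Berwald metrics, Randers metrics -/

section Finsler

variable (n : ℕ) (M : Type*) [TopologicalSpace M] [ChartedSpace (EuclideanSpace ℝ (Fin n)) M]
  [IsManifold (𝓡 n) ∞ M]

/-- A (positively homogeneous) Finsler metric on an `n`-dimensional smooth manifold. -/
structure FinslerMetric where
  /-- The Finsler function. -/
  toFun : ∀ x : M, TangentSpace (𝓡 n) x → ℝ
  nonneg : ∀ x y, 0 ≤ toFun x y
  continuous : Continuous (fun v : TangentBundle (𝓡 n) M => toFun v.proj v.snd)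
  smooth : ContMDiffOn (𝓡 n).tangent 𝓘(ℝ, ℝ) ∞
    (fun v : TangentBundle (𝓡 n) M => toFun v.proj v.snd) {v | v.snd ≠ 0}
  homogeneous : ∀ x (t : ℝ) (y : TangentSpace (𝓡 n) x), 0 ≤ t → toFun x (t • y) = t * toFun x y
  convex : ∀ x (y u : TangentSpace (𝓡 n) x), y ≠ 0 → u ≠ 0 →
    0 < fundamentalTensor (toFun x) y u u

/-- A smooth Riemannian metric on an `n`-dimensional smooth manifold. -/
abbrev RiemMetric :=
  Bundle.ContMDiffRiemannianMetric (𝓡 n) ∞ (EuclideanSpace ℝ (Fin n))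
    (fun x : M => TangentSpace (𝓡 n) x)

variable {n M}

/-- The Finsler function in the natural coordinates of a chart `φ`:
`(x, y) ↦ F(y^i ∂/∂x^i)` at the point with coordinates `x`. -/
def FinslerMetric.inChart (F : FinslerMetric n M)
    (φ : OpenPartialHomeomorph M (EuclideanSpace ℝ (Fin n)))
    (ξ η : EuclideanSpace ℝ (Fin n)) : ℝ :=
  F.toFun (φ.symm ξ) (mfderiv (𝓡 n) (𝓡 n) φ.symm ξ η)

/-- `F` is of Berwald type: in all natural coordinate systems the Chern connection coefficients
`Γ^i_jk(x, y)` do not depend on `y ≠ 0`. -/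
def FinslerMetric.IsBerwald (F : FinslerMetric n M) : Prop :=
  ∀ φ ∈ IsManifold.maximalAtlas (𝓡 n) ∞ M, ∀ ξ ∈ φ.target,
    ∀ η η' : EuclideanSpace ℝ (Fin n), η ≠ 0 → η' ≠ 0 → ∀ i j k : Fin n,
      chernCoeff (F.inChart φ) ξ η i j k = chernCoeff (F.inChart φ) ξ η' i j k

/-- `F` is the Randers metric defined by the Riemannian metric `a` and the smooth vector field `X`
with `a(X, X) < 1`, that is `F(x, y) = √a_x(y, y) + a_x(X, y)`. -/
structure FinslerMetric.IsRanders (F : FinslerMetric n M) (a : RiemMetric n M)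
    (X : ∀ x : M, TangentSpace (𝓡 n) x) : Prop where
  smooth : ContMDiff (𝓡 n) (𝓡 n).tangent ∞ (fun x => (⟨x, X x⟩ : TangentBundle (𝓡 n) M))
  norm_lt_one : ∀ x, a.inner x (X x) (X x) < 1
  eq : ∀ x y, F.toFun x y = √(a.inner x y y) + a.inner x (X x) y

end Finsler

/-! ### Homogeneous spaces

A homogeneous space is given by a smooth transitive action of a Lie group `G` on `M`; after the
choice of an origin `p`, it is `G/H` with `H` the isotropy subgroup of `p`. -/

section Homogeneous

variable {d n : ℕ}
  {G : Type*} [TopologicalSpace G] [ChartedSpace (EuclideanSpace ℝ (Fin d)) G] [Group G]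
  {M : Type*} [TopologicalSpace M] [ChartedSpace (EuclideanSpace ℝ (Fin n)) M]
  [MulAction G M]

/-- `Ad(h)`, the differential at `1` of the conjugation `g ↦ h g h⁻¹`
(the target `T_{h 1 h⁻¹} G` is `T_1 G`). -/
def Ad (h : G) : GroupLieAlgebra (𝓡 d) G →L[ℝ] GroupLieAlgebra (𝓡 d) G :=
  mfderiv (𝓡 d) (𝓡 d) (fun g : G => h * g * h⁻¹) 1

/-- The differential at `1` of the projection `π : G → M`, `g ↦ g • p`
(the target `T_{1 • p} M` is `T_p M`). It sends `Z` to the value at `p` of the fundamental vector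
field of `Z`. -/
def dπ (G : Type*) [TopologicalSpace G] [ChartedSpace (EuclideanSpace ℝ (Fin d)) G] [Group G]
    [MulAction G M] (p : M) : GroupLieAlgebra (𝓡 d) G →L[ℝ] TangentSpace (𝓡 n) p :=
  mfderiv (𝓡 d) (𝓡 n) (fun g : G => g • p) 1

/-- The Lie algebra of the isotropy subgroup `H = π⁻¹(p)` of `p`, as the tangent space at `1` of
this fibre of `π`: the vectors whose fundamental vector field vanishes at `p`. -/
def isotropyAlgebra (G : Type*) [TopologicalSpace G] [ChartedSpace (EuclideanSpace ℝ (Fin d)) G]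
    [Group G] [MulAction G M] (p : M) : Submodule ℝ (GroupLieAlgebra (𝓡 d) G) :=
  LinearMap.ker (dπ (d := d) (n := n) G p).toLinearMap

/-- `𝔤 = 𝔪 ⊕ 𝔥` is a reductive decomposition: `𝔪` is a linear complement of `𝔥` with
`Ad(H) 𝔪 ⊆ 𝔪`. -/
structure IsReductiveDecomposition (p : M) (m : Submodule ℝ (GroupLieAlgebra (𝓡 d) G)) :
    Prop where
  isCompl : IsCompl m (isotropyAlgebra (d := d) (n := n) G p)
  ad_mem : ∀ h ∈ MulAction.stabilizer G p, ∀ x ∈ m, Ad h x ∈ m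

/-- `[x, u]_𝔪`, the `𝔪`-component of the Lie bracket of `x` and `u`. -/
def IsReductiveDecomposition.bracket {p : M} {m : Submodule ℝ (GroupLieAlgebra (𝓡 d) G)}
    (hm : IsReductiveDecomposition (n := n) p m) (x u : m) : m :=
  m.projectionOnto (isotropyAlgebra (d := d) (n := n) G p) hm.isCompl
    ⁅(x : GroupLieAlgebra (𝓡 d) G), (u : GroupLieAlgebra (𝓡 d) G)⁆

variable [IsManifold (𝓡 n) ∞ M]

/-- `G` acts on `M` by isometries of the Finsler metric `F`. -/
def FinslerMetric.IsInvariant (F : FinslerMetric n M) (G : Type*) [Group G] [MulAction G M] :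
    Prop :=
  ∀ (g : G) (x : M) (y : TangentSpace (𝓡 n) x),
    F.toFun (g • x) (mfderiv (𝓡 n) (𝓡 n) (fun z : M => g • z) x y) = F.toFun x y

/-- `G` acts on `M` by isometries of the Riemannian metric `a`. -/
def RiemMetric.IsInvariant (a : RiemMetric n M) (G : Type*) [Group G] [MulAction G M] : Prop :=
  ∀ (g : G) (x : M) (u v : TangentSpace (𝓡 n) x),
    a.inner (g • x) (mfderiv (𝓡 n) (𝓡 n) (fun z : M => g • z) x u)
      (mfderiv (𝓡 n) (𝓡 n) (fun z : M => g • z) x v) = a.inner x u v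

/-- The Minkowski norm induced on `𝔪 ≃ T_p M` by `F`. -/
def FinslerMetric.onComplement (F : FinslerMetric n M) (p : M)
    (m : Submodule ℝ (GroupLieAlgebra (𝓡 d) G)) (y : m) : ℝ :=
  F.toFun p (dπ (d := d) (n := n) G p y)

/-- The inner product induced on `𝔪 ≃ T_p M` by `a`. -/
def RiemMetric.onComplement (a : RiemMetric n M) (p : M)
    (m : Submodule ℝ (GroupLieAlgebra (𝓡 d) G)) (u v : m) : ℝ :=
  a.inner p (dπ (d := d) (n := n) G p u) (dπ (d := d) (n := n) G p v)

/-- The homogeneous space `M = G/H` with the metric `F` is a naturally reductive homogeneous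
Finsler space: `F` is `G`-invariant, and there is a reductive decomposition `𝔤 = 𝔪 ⊕ 𝔥` such that
`g_y([x, u]_𝔪, v) + g_y(u, [x, v]_𝔪) + 2 C_y([x, y]_𝔪, u, v) = 0` on `𝔪`, for `y ≠ 0`. -/
def FinslerMetric.IsNaturallyReductive (F : FinslerMetric n M) (d : ℕ) (G : Type*)
    [TopologicalSpace G] [ChartedSpace (EuclideanSpace ℝ (Fin d)) G] [Group G] [MulAction G M]
    (p : M) : Prop :=
  F.IsInvariant G ∧
  ∃ (m : Submodule ℝ (GroupLieAlgebra (𝓡 d) G)) (hm : IsReductiveDecomposition (n := n) p m),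
    ∀ y x u v : m, y ≠ 0 →
      fundamentalTensor (F.onComplement p m) y (hm.bracket x u) v
        + fundamentalTensor (F.onComplement p m) y u (hm.bracket x v)
        + 2 * cartanTensor (F.onComplement p m) y (hm.bracket x y) u v = 0

/-- The homogeneous space `M = G/H` with the metric `a` is a naturally reductive Riemannian
homogeneous space: `a` is `G`-invariant, and there is a reductive decomposition `𝔤 = 𝔪 ⊕ 𝔥` such
that `⟨[x, y]_𝔪, z⟩ + ⟨y, [x, z]_𝔪⟩ = 0` on `𝔪`. -/
def RiemMetric.IsNaturallyReductive (a : RiemMetric n M) (d : ℕ) (G : Type*)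
    [TopologicalSpace G] [ChartedSpace (EuclideanSpace ℝ (Fin d)) G] [Group G] [MulAction G M]
    (p : M) : Prop :=
  RiemMetric.IsInvariant a G ∧
  ∃ (m : Submodule ℝ (GroupLieAlgebra (𝓡 d) G)) (hm : IsReductiveDecomposition (n := n) p m),
    ∀ x y z : m,
      RiemMetric.onComplement a p m (hm.bracket x y) z
        + RiemMetric.onComplement a p m y (hm.bracket x z) = 0

end Homogeneous

end HomFinsler

end

/-! Write `F = α + β`, with `α` the norm of `ã` and `β = ã(X, ·)`. For a fixed reductive complement
`𝔪` and `x ∈ 𝔪`, put `T = [x, ·]_𝔪`. The Finsler condition says that the flow of `T` preserves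
`g_y`. As `α` is even and `β` odd in `y`, this happens exactly when `T` is skew for `ã` and `β ∘ T =
0` (`forall_fundamentalTensor_randersNorm_iff`). So natural reductivity of `F` is natural
reductivity of `ã` with the same `𝔪`, together with `β([x, y]_𝔪) = 0`. It remains to see that this
last equation always holds.

Full parallelism of `X` is not needed for it; closedness of `β` suffices. Contracted twice with `y`,
the Chern coefficients give the Euler-Lagrange expression of `F²/2` (`randersTensor_chernVector`).
If they do not depend on `y`, the contraction is even in `y`, and comparing `y` with `-y` isolates
the only odd term, which is `dβ` (`fderiv_linear_comm`). The form `β` is also `G`-invariant, by the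
same parity argument (`FinslerMetric.IsRanders.isInvariant`, which gives the invariance of `ã` too).
Hence its pullback to `G` along the orbit map is a closed left-invariant form `ω`, and `0 = dω(x, y)
= -ω([x, y])` (`closed_invariant_form_bracket`). Since `𝔥` is the kernel of the differential of the
orbit map, passing to the `𝔪`-component changes nothing. -/

namespace HomFinsler

/-! ### Linear algebra of Randers norms: fundamental tensor, Cartan tensor, infinitesimal
isometries. -/

section RandersNorm

variable {V : Type*} [AddCommGroup V] [Module ℝ V]

/-- The Randers norm `√A(y, y) + b(y)` of a bilinear form `A` and a linear form `b`. -/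
noncomputable def randersNorm (A : V →ₗ[ℝ] V →ₗ[ℝ] ℝ) (b : V →ₗ[ℝ] ℝ) (y : V) : ℝ :=
  √(A y y) + b y

/-- The differential of `randersNorm A b` at `y`, in the direction `v`. -/
noncomputable def randersMomentum (A : V →ₗ[ℝ] V →ₗ[ℝ] ℝ) (b : V →ₗ[ℝ] ℝ) (y v : V) : ℝ :=
  A y v / √(A y y) + b v

/-- The fundamental tensor of `randersNorm A b`. -/
noncomputable def randersTensor (A : V →ₗ[ℝ] V →ₗ[ℝ] ℝ) (b : V →ₗ[ℝ] ℝ) (y u v : V) : ℝ :=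
  A u v + b u * b v + (A y u * b v + A y v * b u) / √(A y y)
    + b y * (A u v / √(A y y) - A y u * A y v / √(A y y) ^ 3)

/-- The derivative of `randersTensor A b y u v` with respect to `y`, in the direction `w`. -/
noncomputable def randersTensorDeriv (A : V →ₗ[ℝ] V →ₗ[ℝ] ℝ) (b : V →ₗ[ℝ] ℝ) (y u v w : V) : ℝ :=
  (A w u * b v + A w v * b u) / √(A y y)
    - (A y u * b v + A y v * b u) * A y w / √(A y y) ^ 3
    + b w * (A u v / √(A y y) - A y u * A y v / √(A y y) ^ 3)
    + b y * (- (A u v * A y w + A w u * A y v + A y u * A w v) / √(A y y) ^ 3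
      + 3 * A y u * A y v * A y w / √(A y y) ^ 5)

variable {A : V →ₗ[ℝ] V →ₗ[ℝ] ℝ} {b : V →ₗ[ℝ] ℝ} {y : V}

lemma hasDerivAt_linear_line (f : V →ₗ[ℝ] ℝ) (y v : V) (t : ℝ) :
    HasDerivAt (fun t : ℝ => f (y + t • v)) (f v) t := by
  have := ((hasDerivAt_id t).mul_const (f v)).const_add (f y)
  simpa using this

lemma hasDerivAt_sqrt_line (hs : ∀ u v, A u v = A v u) (hy : 0 < A y y) (v : V) :
    HasDerivAt (fun t : ℝ => √(A (y + t • v) (y + t • v))) (A y v / √(A y y)) 0 := by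
  have h1 : HasDerivAt (fun t : ℝ => A y y + (t * (2 * A y v) + t * t * A v v))
      (2 * A y v) 0 := by
    have := ((((hasDerivAt_id (0 : ℝ)).mul_const (2 * A y v)).add
      (((hasDerivAt_id (0 : ℝ)).mul (hasDerivAt_id (0 : ℝ))).mul_const (A v v))).const_add (A y y))
    simpa using this
  have h2 : (fun t : ℝ => A (y + t • v) (y + t • v))
      = fun t : ℝ => A y y + (t * (2 * A y v) + t * t * A v v) := by
    funext t
    simp only [map_add, map_smul, LinearMap.add_apply, LinearMap.smul_apply, smul_eq_mul, hs v y]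
    ring
  rw [← h2] at h1
  have := h1.sqrt (by simpa using hy.ne')
  convert this using 1
  simp only [zero_smul, add_zero]
  field_simp

/-- Second derivatives at `y` need the formula for the first derivative at all nearby points of the
line, where the square root must still be differentiable. -/
lemma eventually_line_pos (hs : ∀ u v, A u v = A v u) (hy : 0 < A y y) (v : V) :
    ∀ᶠ t : ℝ in nhds 0, 0 < A (y + t • v) (y + t • v) := by
  have h := (hasDerivAt_sqrt_line hs hy v).continuousAt.eventually
    (lt_mem_nhds (a := 0) (by simpa using hy))
  filter_upwards [h] with t ht
  exact Real.sqrt_pos.1 ht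

lemma hasDerivAt_randersNorm (hs : ∀ u v, A u v = A v u) (hy : 0 < A y y) (v : V) :
    HasDerivAt (fun t : ℝ => randersNorm A b (y + t • v)) (randersMomentum A b y v) 0 :=
  (hasDerivAt_sqrt_line hs hy v).add (hasDerivAt_linear_line b y v 0)

lemma hasDerivAt_randersMomentum (hs : ∀ u v, A u v = A v u) (hy : 0 < A y y) (u v : V) :
    HasDerivAt (fun t : ℝ => randersMomentum A b (y + t • u) v)
      (A u v / √(A y y) - A y u * A y v / √(A y y) ^ 3) 0 := by
  have hr : 0 < √(A y y) := Real.sqrt_pos.2 hy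
  have h1 := ((hasDerivAt_linear_line (A.flip v) y u 0).div (hasDerivAt_sqrt_line hs hy u)
    (by simpa using hr.ne')).add_const (b v)
  simp only [LinearMap.flip_apply, zero_smul, add_zero] at h1
  have h2 : (A u v * √(A y y) - A y v * (A y u / √(A y y))) / √(A y y) ^ 2
      = A u v / √(A y y) - A y u * A y v / √(A y y) ^ 3 := by
    field_simp
  exact h2 ▸ h1

theorem fundamentalTensor_randersNorm (hs : ∀ u v, A u v = A v u) (hy : 0 < A y y) (u v : V) :
    fundamentalTensor (randersNorm A b) y u v = randersTensor A b y u v := by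
  have hr : 0 < √(A y y) := Real.sqrt_pos.2 hy
  have h1 : (fun s : ℝ => deriv (fun t : ℝ => randersNorm A b (y + s • u + t • v) ^ 2) 0)
      =ᶠ[nhds 0] fun s : ℝ =>
        2 * (randersNorm A b (y + s • u) * randersMomentum A b (y + s • u) v) := by
    filter_upwards [eventually_line_pos hs hy u] with s hpos
    have := ((hasDerivAt_randersNorm (b := b) hs hpos v).pow 2).deriv
    simp only [Pi.pow_def] at this
    rw [this]
    simp
    ring
  have h2 : HasDerivAt
      (fun s : ℝ => 2 * (randersNorm A b (y + s • u) * randersMomentum A b (y + s • u) v)) _ 0 :=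
    ((hasDerivAt_randersNorm (b := b) hs hy u).mul
      (hasDerivAt_randersMomentum (b := b) hs hy u v)).const_mul 2
  rw [fundamentalTensor, h1.deriv_eq, h2.deriv]
  simp only [zero_smul, add_zero]
  have hq : A y y = √(A y y) ^ 2 := (Real.sq_sqrt hy.le).symm
  rw [randersNorm, randersMomentum, randersMomentum, randersTensor]
  field_simp
  ring

theorem hasDerivAt_randersTensor (hs : ∀ u v, A u v = A v u) (hy : 0 < A y y) (u v w : V) :
    HasDerivAt (fun t : ℝ => randersTensor A b (y + t • w) u v)
      (randersTensorDeriv A b y u v w) 0 := by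
  have hr : 0 < √(A y y) := Real.sqrt_pos.2 hy
  have hS := hasDerivAt_sqrt_line hs hy w
  have hu := hasDerivAt_linear_line (A.flip u) y w 0
  have hv := hasDerivAt_linear_line (A.flip v) y w 0
  have hb := hasDerivAt_linear_line b y w 0
  have h0 : √(A (y + (0 : ℝ) • w) (y + (0 : ℝ) • w)) ≠ 0 := by simpa using hr.ne'
  have h := ((((hu.mul_const (b v)).add (hv.mul_const (b u))).div hS h0).const_add
    (A u v + b u * b v)).add (hb.mul (((hasDerivAt_const (0 : ℝ) (A u v)).div hS h0).sub
      ((hu.mul hv).div (hS.pow 3) (pow_ne_zero 3 h0))))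
  refine HasDerivAt.congr_deriv h ?_
  simp only [randersTensorDeriv, LinearMap.flip_apply, zero_smul, add_zero, Pi.pow_apply,
    Pi.add_apply, Pi.mul_apply, Pi.div_apply, Pi.sub_apply]
  field_simp
  ring

theorem cartanTensor_randersNorm (hs : ∀ u v, A u v = A v u) (hy : 0 < A y y) (z u v : V) :
    cartanTensor (randersNorm A b) y z u v = (1 / 2) * randersTensorDeriv A b y z u v := by
  have h : (fun t : ℝ => fundamentalTensor (randersNorm A b) (y + t • v) z u)
      =ᶠ[nhds 0] fun t => randersTensor A b (y + t • v) z u := by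
    filter_upwards [eventually_line_pos hs hy v] with t ht
    exact fundamentalTensor_randersNorm hs ht z u
  rw [cartanTensor, h.deriv_eq, (hasDerivAt_randersTensor hs hy z u v).deriv]

lemma randersTensor_comm (hs : ∀ u v, A u v = A v u) (y u v : V) :
    randersTensor A b y u v = randersTensor A b y v u := by
  simp only [randersTensor, hs u v]
  ring

lemma randersTensor_self_left (hy : 0 < A y y) (v : V) :
    randersTensor A b y y v = randersNorm A b y * randersMomentum A b y v := by
  have hr : 0 < √(A y y) := Real.sqrt_pos.2 hy
  have hq : √(A y y) ^ 2 = A y y := Real.sq_sqrt hy.le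
  simp only [randersTensor, randersNorm, randersMomentum]
  generalize √(A y y) = r at *
  rw [← hq]
  field_simp
  ring

lemma randersMomentum_self :
    randersMomentum A b y y = randersNorm A b y := by
  rw [randersMomentum, randersNorm, Real.div_sqrt]

/-- Euler's relation: `g_y` is homogeneous of degree 0 in `y` and its `y`-derivative is totally
symmetric, so inserting `y` in any slot gives zero. -/
lemma randersTensorDeriv_self_right (hs : ∀ u v, A u v = A v u) (hy : 0 < A y y) (u w : V) :
    randersTensorDeriv A b y u y w = 0 := by
  have hr : 0 < √(A y y) := Real.sqrt_pos.2 hy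
  have hq : √(A y y) ^ 2 = A y y := Real.sq_sqrt hy.le
  simp only [randersTensorDeriv, hs u y, hs w y, hs w u]
  generalize √(A y y) = r at *
  rw [← hq]
  field_simp
  ring

lemma randersTensorDeriv_self_last (hy : 0 < A y y) (u v : V) :
    randersTensorDeriv A b y u v y = 0 := by
  have hr : 0 < √(A y y) := Real.sqrt_pos.2 hy
  have hq : √(A y y) ^ 2 = A y y := Real.sq_sqrt hy.le
  simp only [randersTensorDeriv]
  generalize √(A y y) = r at *
  rw [← hq]
  field_simp
  ring

/-- An endomorphism `T` leaves the fundamental tensor of a Randers norm infinitesimally invariant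
if and only if it is skew and its range lies in the kernel of the linear form. -/
theorem forall_fundamentalTensor_randersNorm_iff (hs : ∀ u v, A u v = A v u)
    (hpos : ∀ y, y ≠ 0 → 0 < A y y) (hN : ∀ y, y ≠ 0 → randersNorm A b y ≠ 0) (T : V →ₗ[ℝ] V) :
    (∀ y u v : V, y ≠ 0 →
      fundamentalTensor (randersNorm A b) y (T u) v + fundamentalTensor (randersNorm A b) y u (T v)
        + 2 * cartanTensor (randersNorm A b) y (T y) u v = 0) ↔
    (∀ y z, A (T y) z + A y (T z) = 0) ∧ ∀ y, b (T y) = 0 := by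
  constructor
  · intro h
    have key : ∀ y, A y (T y) = 0 ∧ b (T y) = 0 := by
      intro y
      rcases eq_or_ne y 0 with rfl | hy
      · simp
      -- With `u = v = y` the Cartan term drops out and what remains is `2 F(y) dF_y(T y) = 0`.
      have hM : ∀ y, y ≠ 0 → randersMomentum A b y (T y) = 0 := by
        intro y hy
        have hyy := hpos y hy
        have h1 := h y y y hy
        rw [fundamentalTensor_randersNorm hs hyy, fundamentalTensor_randersNorm hs hyy,
          cartanTensor_randersNorm hs hyy, randersTensorDeriv_self_last hyy,
          randersTensor_comm hs, randersTensor_self_left hyy] at h1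
        have : randersNorm A b y * randersMomentum A b y (T y) = 0 := by linarith
        exact (mul_eq_zero.1 this).resolve_left (hN y hy)
      have h1 := hM y hy
      -- In `dF_y(T y) = A(y, T y)/α(y) + b(T y)` the first term is even in `y` and the second odd,
      -- so both vanish.
      have h2 := hM (-y) (neg_ne_zero.2 hy)
      have hr : 0 < √(A y y) := Real.sqrt_pos.2 (hpos y hy)
      simp only [randersMomentum, map_neg, LinearMap.neg_apply, neg_neg] at h1 h2
      have h3 : A y (T y) / √(A y y) = 0 := by linarith
      exact ⟨(div_eq_zero_iff.1 h3).resolve_right hr.ne', by linarith⟩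
    refine ⟨fun y z => ?_, fun y => (key y).2⟩
    -- Polarization of `A(y, T y) = 0`.
    have := (key (y + z)).1
    simp only [map_add, LinearMap.add_apply, (key y).1, (key z).1] at this
    rw [hs (T y) z]
    linarith
  · rintro ⟨hT, hb⟩ y u v hy
    have hyy := hpos y hy
    have hr : 0 < √(A y y) := Real.sqrt_pos.2 hyy
    rw [fundamentalTensor_randersNorm hs hyy, fundamentalTensor_randersNorm hs hyy,
      cartanTensor_randersNorm hs hyy]
    have e1 : ∀ w, A y (T w) = - A w (T y) := fun w => by
      have := hT w y; rw [hs (T w) y] at this; linarith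
    have e2 : A y (T y) = 0 := by have := e1 y; linarith
    have e3 : A (T u) v = - A u (T v) := by have := hT u v; linarith
    rw [randersTensor, randersTensor, randersTensorDeriv, hb, hb, hb, e1, e1, e2, e3, hs (T y) u,
      hs v u]
    field_simp
    ring

end RandersNorm

/-! ### Chern coefficients of a Randers metric in coordinates, contracted with the velocity. -/

section RandersLinear

variable {V : Type*} [AddCommGroup V] [Module ℝ V] (A : V →ₗ[ℝ] V →ₗ[ℝ] ℝ) (b : V →ₗ[ℝ] ℝ)

lemma randersTensor_sum_right {ι : Type*} (s : Finset ι) (y u : V) (c : ι → ℝ) (v : ι → V) :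
    randersTensor A b y u (∑ i ∈ s, c i • v i) = ∑ i ∈ s, c i * randersTensor A b y u (v i) := by
  have h : IsLinearMap ℝ (randersTensor A b y u) :=
    ⟨fun v w => by simp only [randersTensor, map_add]; ring,
      fun r v => by simp only [randersTensor, map_smul, smul_eq_mul]; ring⟩
  have := map_sum (h.mk' _) (fun i => c i • v i) s
  simpa only [IsLinearMap.mk'_apply, h.map_smul, smul_eq_mul] using this

lemma randersTensorDeriv_sum_right {ι : Type*} (s : Finset ι) (y u w : V) (c : ι → ℝ)
    (v : ι → V) :
    randersTensorDeriv A b y u (∑ i ∈ s, c i • v i) w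
      = ∑ i ∈ s, c i * randersTensorDeriv A b y u (v i) w := by
  have h : IsLinearMap ℝ (fun v => randersTensorDeriv A b y u v w) :=
    ⟨fun v w => by simp only [randersTensorDeriv, map_add]; ring,
      fun r v => by simp only [randersTensorDeriv, map_smul, smul_eq_mul]; ring⟩
  have := map_sum (h.mk' _) (fun i => c i • v i) s
  simpa only [IsLinearMap.mk'_apply, h.map_smul, smul_eq_mul] using this

end RandersLinear

section Coordinates

variable {n : ℕ}

lemma sum_smul_coordVec (η : EuclideanSpace ℝ (Fin n)) : ∑ i, η i • coordVec i = η := by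
  simpa using (EuclideanSpace.basisFun (Fin n) ℝ).sum_repr η

variable {A : EuclideanSpace ℝ (Fin n) →
    EuclideanSpace ℝ (Fin n) →ₗ[ℝ] EuclideanSpace ℝ (Fin n) →ₗ[ℝ] ℝ}
  {b : EuclideanSpace ℝ (Fin n) → EuclideanSpace ℝ (Fin n) →ₗ[ℝ] ℝ}
  {ξ η : EuclideanSpace ℝ (Fin n)}

lemma metricMatrix_randersNorm (hs : ∀ u v, A ξ u v = A ξ v u) (hη : 0 < A ξ η η) (i j : Fin n) :
    metricMatrix (fun ξ => randersNorm (A ξ) (b ξ)) ξ η i j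
      = randersTensor (A ξ) (b ξ) η (coordVec i) (coordVec j) :=
  fundamentalTensor_randersNorm hs hη _ _

lemma metricDy_randersNorm (hs : ∀ u v, A ξ u v = A ξ v u) (hη : 0 < A ξ η η) (i j k : Fin n) :
    metricDy (fun ξ => randersNorm (A ξ) (b ξ)) ξ η i j k
      = randersTensorDeriv (A ξ) (b ξ) η (coordVec i) (coordVec j) (coordVec k) := by
  rw [metricDy, lineDeriv, ← (hasDerivAt_randersTensor hs hη _ _ _).deriv]
  apply Filter.EventuallyEq.deriv_eq
  filter_upwards [eventually_line_pos hs hη (coordVec k)] with t ht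
  exact metricMatrix_randersNorm hs ht i j

lemma sum_metricDy_randersNorm (hs : ∀ u v, A ξ u v = A ξ v u) (hη : 0 < A ξ η η) (i k : Fin n) :
    ∑ j, η j * metricDy (fun ξ => randersNorm (A ξ) (b ξ)) ξ η i j k = 0 := by
  simp only [metricDy_randersNorm hs hη]
  rw [← randersTensorDeriv_sum_right, sum_smul_coordVec]
  exact randersTensorDeriv_self_right hs hη _ _

/-- The correction term `N^m_k ∂g_ij/∂y^m` dies when contracted with `η^j`, because the Cartan
tensor kills `η`. The nonlinear connection therefore never has to be computed. -/
lemma sum_metricHorizontal_randersNorm (hs : ∀ u v, A ξ u v = A ξ v u) (hη : 0 < A ξ η η)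
    (i k : Fin n) :
    ∑ j, η j * metricHorizontal (fun ξ => randersNorm (A ξ) (b ξ)) ξ η i j k
      = ∑ j, η j * metricDx (fun ξ => randersNorm (A ξ) (b ξ)) ξ η i j k := by
  simp only [metricHorizontal, mul_sub, Finset.sum_sub_distrib, Finset.mul_sum]
  rw [Finset.sum_comm, sub_eq_self]
  refine Finset.sum_eq_zero fun m _ => ?_
  rw [← mul_zero (nonlinearConnection (fun ξ => randersNorm (A ξ) (b ξ)) ξ η m k),
    ← sum_metricDy_randersNorm (b := b) hs hη i m, Finset.mul_sum]
  exact Finset.sum_congr rfl fun j _ => by ring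

lemma differentiableAt_sqrt_metric
    (hd : ∀ u v, DifferentiableAt ℝ (fun ξ => A ξ u v) ξ)
    (hη : 0 < A ξ η η) :
    DifferentiableAt ℝ (fun ξ => √(A ξ η η)) ξ :=
  (hd η η).sqrt hη.ne'

lemma differentiableAt_unit_covector
    (hd : ∀ u v, DifferentiableAt ℝ (fun ξ => A ξ u v) ξ)
    (hη : 0 < A ξ η η) (u : EuclideanSpace ℝ (Fin n)) :
    DifferentiableAt ℝ (fun ξ => A ξ η u / √(A ξ η η)) ξ := by
  have h := differentiableAt_sqrt_metric hd hη
  simp only [div_eq_mul_inv]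
  refine (hd η u).fun_mul (h.fun_inv ?_)
  exact (Real.sqrt_pos.2 hη).ne'

lemma differentiableAt_randersNorm
    (hd : ∀ u v, DifferentiableAt ℝ (fun ξ => A ξ u v) ξ)
    (hb : ∀ u, DifferentiableAt ℝ (fun ξ => b ξ u) ξ)
    (hη : 0 < A ξ η η) :
    DifferentiableAt ℝ (fun ξ => randersNorm (A ξ) (b ξ) η) ξ :=
  (differentiableAt_sqrt_metric hd hη).add (hb η)

lemma differentiableAt_randersMomentum
    (hd : ∀ u v, DifferentiableAt ℝ (fun ξ => A ξ u v) ξ)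
    (hb : ∀ u, DifferentiableAt ℝ (fun ξ => b ξ u) ξ)
    (hη : 0 < A ξ η η) (u : EuclideanSpace ℝ (Fin n)) :
    DifferentiableAt ℝ (fun ξ => randersMomentum (A ξ) (b ξ) η u) ξ :=
  (differentiableAt_unit_covector hd hη u).add (hb u)

lemma differentiableAt_randersTensor
    (hd : ∀ u v, DifferentiableAt ℝ (fun ξ => A ξ u v) ξ)
    (hb : ∀ u, DifferentiableAt ℝ (fun ξ => b ξ u) ξ)
    (hη : 0 < A ξ η η) (u v : EuclideanSpace ℝ (Fin n)) :
    DifferentiableAt ℝ (fun ξ => randersTensor (A ξ) (b ξ) η u v) ξ := by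
  have hα := differentiableAt_sqrt_metric hd hη
  have hdiv : ∀ k {f : EuclideanSpace ℝ (Fin n) → ℝ}, DifferentiableAt ℝ f ξ →
      DifferentiableAt ℝ (fun ξ => f ξ / √(A ξ η η) ^ k) ξ := fun k f hf => by
    have h := hα.fun_pow k
    simp only [div_eq_mul_inv]
    refine hf.fun_mul (h.fun_inv ?_)
    exact pow_ne_zero k (Real.sqrt_pos.2 hη).ne'
  have h1 := hdiv 1 (((hd η u).fun_mul (hb v)).fun_add ((hd η v).fun_mul (hb u)))
  have h2 := hdiv 1 (hd u v)
  simp only [pow_one] at h1 h2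
  exact (((hd u v).fun_add ((hb u).fun_mul (hb v))).fun_add h1).fun_add
    ((hb η).fun_mul (h2.fun_sub (hdiv 3 ((hd η u).fun_mul (hd η v)))))

lemma metricDx_randersNorm
    (hd : ∀ u v, DifferentiableAt ℝ (fun ξ => A ξ u v) ξ)
    (hb : ∀ u, DifferentiableAt ℝ (fun ξ => b ξ u) ξ)
    (hs : ∀ᶠ ξ' in nhds ξ, ∀ u v, A ξ' u v = A ξ' v u)
    (hpos : ∀ᶠ ξ' in nhds ξ, ∀ η, η ≠ 0 → 0 < A ξ' η η)
    (hη : η ≠ 0) (i j k : Fin n) :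
    metricDx (fun ξ => randersNorm (A ξ) (b ξ)) ξ η i j k
      = fderiv ℝ (fun ξ => randersTensor (A ξ) (b ξ) η (coordVec i) (coordVec j)) ξ
        (coordVec k) := by
  rw [← (differentiableAt_randersTensor hd hb (hpos.self_of_nhds η hη) _ _).lineDeriv_eq_fderiv,
    metricDx]
  apply Filter.EventuallyEq.lineDeriv_eq
  filter_upwards [hs, hpos] with ξ' h1 h2
  exact metricMatrix_randersNorm h1 (h2 η hη) i j

/-- By Euler's relation `g_ij η^j = F ∂F/∂y^i`, and `η` is held fixed when differentiating in `x`.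
-/
lemma sum_metricDx_randersNorm
    (hd : ∀ u v, DifferentiableAt ℝ (fun ξ => A ξ u v) ξ)
    (hb : ∀ u, DifferentiableAt ℝ (fun ξ => b ξ u) ξ)
    (hs : ∀ᶠ ξ' in nhds ξ, ∀ u v, A ξ' u v = A ξ' v u)
    (hpos : ∀ᶠ ξ' in nhds ξ, ∀ η, η ≠ 0 → 0 < A ξ' η η)
    (hη : η ≠ 0) (i k : Fin n) :
    ∑ j, η j * metricDx (fun ξ => randersNorm (A ξ) (b ξ)) ξ η i j k
      = fderiv ℝ (fun ξ => randersNorm (A ξ) (b ξ) η * randersMomentum (A ξ) (b ξ) η (coordVec i)) ξ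
        (coordVec k) := by
  have hη' := hpos.self_of_nhds η hη
  have h : (fun ξ => randersNorm (A ξ) (b ξ) η * randersMomentum (A ξ) (b ξ) η (coordVec i))
      =ᶠ[nhds ξ] fun ξ => ∑ j, η j * randersTensor (A ξ) (b ξ) η (coordVec i) (coordVec j) := by
    filter_upwards [hs, hpos] with ξ' h1 h2
    rw [← randersTensor_sum_right, sum_smul_coordVec, randersTensor_comm h1,
      randersTensor_self_left (h2 η hη)]
  rw [h.fderiv_eq, fderiv_fun_sum fun j _ =>
    (differentiableAt_randersTensor hd hb hη' _ _).const_mul _, sum_apply]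
  refine Finset.sum_congr rfl fun j _ => ?_
  rw [metricDx_randersNorm hd hb hs hpos hη,
    fderiv_const_mul (differentiableAt_randersTensor hd hb hη' _ _)]
  rfl

lemma sum_fderiv_coordVec (f : EuclideanSpace ℝ (Fin n) →L[ℝ] ℝ) (η : EuclideanSpace ℝ (Fin n)) :
    ∑ k, η k * f (coordVec k) = f η := by
  conv_rhs => rw [← sum_smul_coordVec η]
  simp

/-- The vector `Γ^i_jk(ξ, η) η^j η^k`. -/
noncomputable def chernVector (L : EuclideanSpace ℝ (Fin n) → EuclideanSpace ℝ (Fin n) → ℝ)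
    (ξ η : EuclideanSpace ℝ (Fin n)) : EuclideanSpace ℝ (Fin n) :=
  ∑ i, (∑ j, ∑ k, chernCoeff L ξ η i j k * η j * η k) • coordVec i

end Coordinates

/-! ### The Euler-Lagrange expression and the closedness of the linear form. -/

section Coordinates

variable {n : ℕ} {A : EuclideanSpace ℝ (Fin n) →
    EuclideanSpace ℝ (Fin n) →ₗ[ℝ] EuclideanSpace ℝ (Fin n) →ₗ[ℝ] ℝ}
  {b : EuclideanSpace ℝ (Fin n) → EuclideanSpace ℝ (Fin n) →ₗ[ℝ] ℝ}
  {ξ η : EuclideanSpace ℝ (Fin n)}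

/-- The matrix inverse is a genuine one only for nonzero determinant; a kernel vector `v` would give
`g_η(v, v) = 0`, against strong convexity. -/
lemma metricMatrix_mul_inv (hs : ∀ u v, A ξ u v = A ξ v u) (hη : 0 < A ξ η η)
    (hconv : ∀ u, u ≠ 0 → 0 < randersTensor (A ξ) (b ξ) η u u) :
    metricMatrix (fun ξ => randersNorm (A ξ) (b ξ)) ξ η
      * (metricMatrix (fun ξ => randersNorm (A ξ) (b ξ)) ξ η)⁻¹ = 1 := by
  refine Matrix.mul_nonsing_inv _ (isUnit_iff_ne_zero.2 fun h0 => ?_)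
  obtain ⟨v, hv, h⟩ := Matrix.exists_mulVec_eq_zero_iff.2 h0
  have hv' : WithLp.toLp 2 v ≠ (0 : EuclideanSpace ℝ (Fin n)) := fun h => hv (by simpa using h)
  have hsum := sum_smul_coordVec (WithLp.toLp 2 v)
  have h1 : ∀ i, randersTensor (A ξ) (b ξ) η (coordVec i) (WithLp.toLp 2 v) = 0 := by
    intro i
    rw [← hsum, randersTensor_sum_right]
    refine Eq.trans ?_ (congrFun h i)
    rw [Matrix.mulVec, dotProduct]
    exact Finset.sum_congr rfl fun j _ => by rw [metricMatrix_randersNorm hs hη, mul_comm]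
  refine (hconv _ hv').ne' ?_
  nth_rw 2 [← hsum]
  rw [randersTensor_sum_right]
  exact Finset.sum_eq_zero fun i _ => by rw [randersTensor_comm hs, h1, mul_zero]

/-- Lowering the index cancels `g^{il}`. In the contraction with `η^j η^k` the first two terms of
the Christoffel-type sum coincide, each giving the `η`-derivative of `F ∂F/∂y^l`, and the third
gives the `l`-th derivative of `F²`. -/
theorem randersTensor_chernVector
    (hd : ∀ u v, DifferentiableAt ℝ (fun ξ => A ξ u v) ξ)
    (hb : ∀ u, DifferentiableAt ℝ (fun ξ => b ξ u) ξ)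
    (hs : ∀ᶠ ξ' in nhds ξ, ∀ u v, A ξ' u v = A ξ' v u)
    (hpos : ∀ᶠ ξ' in nhds ξ, ∀ η, η ≠ 0 → 0 < A ξ' η η)
    (hconv : ∀ u, u ≠ 0 → 0 < randersTensor (A ξ) (b ξ) η u u)
    (hη : η ≠ 0) (u : EuclideanSpace ℝ (Fin n)) :
    randersTensor (A ξ) (b ξ) η u (chernVector (fun ξ => randersNorm (A ξ) (b ξ)) ξ η)
      = fderiv ℝ (fun ξ => randersNorm (A ξ) (b ξ) η * randersMomentum (A ξ) (b ξ) η u) ξ η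
        - (1 / 2) * fderiv ℝ (fun ξ => randersNorm (A ξ) (b ξ) η ^ 2) ξ u := by
  set L := fun ξ => randersNorm (A ξ) (b ξ)
  have hs0 := hs.self_of_nhds
  have hη' := hpos.self_of_nhds η hη
  have hN := differentiableAt_randersNorm hd hb hη'
  have hM := differentiableAt_randersMomentum hd hb hη'
  -- `F dF_η(v)` is linear in `v`, so its differential can be assembled from coordinate vectors.
  have hdM : ∀ v, fderiv ℝ (fun ξ => randersNorm (A ξ) (b ξ) η * randersMomentum (A ξ) (b ξ) η v) ξ
      = ∑ l, v l • fderiv ℝ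
        (fun ξ => randersNorm (A ξ) (b ξ) η * randersMomentum (A ξ) (b ξ) η (coordVec l)) ξ := by
    intro v
    have : (fun ξ => randersNorm (A ξ) (b ξ) η * randersMomentum (A ξ) (b ξ) η v)
        = fun ξ => ∑ l, v l *
          (randersNorm (A ξ) (b ξ) η * randersMomentum (A ξ) (b ξ) η (coordVec l)) := by
      funext ξ'
      conv_lhs => rw [← sum_smul_coordVec v]
      simp only [randersMomentum, map_sum, map_smul, smul_eq_mul, Finset.mul_sum, Finset.sum_div,
        ← Finset.sum_add_distrib]
      exact Finset.sum_congr rfl fun l _ => by ring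
    rw [this, fderiv_fun_sum fun l _ => (hN.fun_mul (hM _)).const_mul _]
    exact Finset.sum_congr rfl fun l _ => fderiv_const_mul (hN.fun_mul (hM _)) _
  have hsq : (fun ξ => randersNorm (A ξ) (b ξ) η ^ 2)
      = fun ξ => randersNorm (A ξ) (b ξ) η * randersMomentum (A ξ) (b ξ) η η := by
    funext ξ'
    rw [randersMomentum_self, sq]
  have key : ∀ l, randersTensor (A ξ) (b ξ) η (coordVec l) (chernVector L ξ η)
      = fderiv ℝ (fun ξ => randersNorm (A ξ) (b ξ) η * randersMomentum (A ξ) (b ξ) η (coordVec l))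
          ξ η - (1 / 2) * fderiv ℝ (fun ξ => randersNorm (A ξ) (b ξ) η ^ 2) ξ (coordVec l) := by
    intro l
    have hcoord : ∀ i, ∑ j, ∑ k, chernCoeff L ξ η i j k * η j * η k
        = ∑ m, (metricMatrix L ξ η)⁻¹ i m * ((1 / 2) * ∑ j, ∑ k,
          (metricHorizontal L ξ η m k j + metricHorizontal L ξ η m j k
            - metricHorizontal L ξ η j k m) * η j * η k) := by
      intro i
      simp only [chernCoeff, Finset.mul_sum, Finset.sum_mul]
      conv_rhs => rw [Finset.sum_comm]
      refine Finset.sum_congr rfl fun j _ => ?_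
      rw [Finset.sum_comm]
      exact Finset.sum_congr rfl fun m _ => Finset.sum_congr rfl fun k _ => by ring
    have hinv : randersTensor (A ξ) (b ξ) η (coordVec l) (chernVector L ξ η)
        = (1 / 2) * ∑ j, ∑ k,
          (metricHorizontal L ξ η l k j + metricHorizontal L ξ η l j k
            - metricHorizontal L ξ η j k l) * η j * η k := by
      set Y : Fin n → ℝ := fun m => (1 / 2) * ∑ j, ∑ k,
          (metricHorizontal L ξ η m k j + metricHorizontal L ξ η m j k
            - metricHorizontal L ξ η j k m) * η j * η k
      have h1 : (metricMatrix L ξ η).mulVec ((metricMatrix L ξ η)⁻¹.mulVec Y) = Y := by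
        rw [Matrix.mulVec_mulVec, metricMatrix_mul_inv hs0 hη' hconv, Matrix.one_mulVec]
      rw [chernVector, randersTensor_sum_right]
      refine Eq.trans ?_ (congrFun h1 l)
      rw [Matrix.mulVec, dotProduct]
      refine Finset.sum_congr rfl fun i _ => ?_
      rw [metricMatrix_randersNorm hs0 hη', hcoord, mul_comm]
      rfl
    have hA : ∀ j, ∑ k, metricHorizontal L ξ η l k j * η j * η k = η j * fderiv ℝ
        (fun ξ => randersNorm (A ξ) (b ξ) η * randersMomentum (A ξ) (b ξ) η (coordVec l)) ξ
          (coordVec j) := by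
      intro j
      rw [← sum_metricDx_randersNorm hd hb hs hpos hη, ← sum_metricHorizontal_randersNorm hs0 hη',
        Finset.mul_sum]
      exact Finset.sum_congr rfl fun k _ => by ring
    have hB : ∀ j, ∑ k, metricHorizontal L ξ η j k l * η j * η k = η j * fderiv ℝ
        (fun ξ => randersNorm (A ξ) (b ξ) η * randersMomentum (A ξ) (b ξ) η (coordVec j)) ξ
          (coordVec l) := by
      intro j
      rw [← sum_metricDx_randersNorm hd hb hs hpos hη, ← sum_metricHorizontal_randersNorm hs0 hη',
        Finset.mul_sum]
      exact Finset.sum_congr rfl fun k _ => by ring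
    have hA' := Finset.sum_congr rfl fun j (_ : j ∈ Finset.univ) => hA j
    have hB' := Finset.sum_congr rfl fun j (_ : j ∈ Finset.univ) => hB j
    rw [sum_fderiv_coordVec] at hA'
    have hA'' : ∑ j, ∑ k, metricHorizontal L ξ η l j k * η j * η k
        = ∑ j, ∑ k, metricHorizontal L ξ η l k j * η j * η k := by
      rw [Finset.sum_comm]
      exact Finset.sum_congr rfl fun j _ => Finset.sum_congr rfl fun k _ => by ring
    rw [hinv, hsq, hdM η, sum_apply]
    simp only [sub_mul, add_mul, Finset.sum_add_distrib, Finset.sum_sub_distrib,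
      smul_apply, smul_eq_mul]
    rw [hA'', hA', hB']
    ring
  rw [randersTensor_comm hs0]
  conv_lhs => rw [← sum_smul_coordVec u, randersTensor_sum_right]
  simp only [fun i => randersTensor_comm (b := b ξ) (y := η) hs0 (chernVector L ξ η) (coordVec i),
    key, mul_sub, Finset.sum_sub_distrib]
  rw [hdM u, sum_apply]
  congr 1
  rw [← sum_fderiv_coordVec _ u, Finset.mul_sum]
  exact Finset.sum_congr rfl fun k _ => by ring

/-- Since `g = F · Hess F + dF ⊗ dF` and `β` is linear on fibres, `Hess F = Hess α`. Removing the
`dF` terms and dividing by `F` leaves an identity in which `β` enters only through `dβ(η, u)`; all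
other terms are even in `η` once `c` is fixed. -/
theorem covector_chernVector
    (hd : ∀ u v, DifferentiableAt ℝ (fun ξ => A ξ u v) ξ)
    (hb : ∀ u, DifferentiableAt ℝ (fun ξ => b ξ u) ξ)
    (hs : ∀ᶠ ξ' in nhds ξ, ∀ u v, A ξ' u v = A ξ' v u)
    (hpos : ∀ᶠ ξ' in nhds ξ, ∀ η, η ≠ 0 → 0 < A ξ' η η)
    (hconv : ∀ u, u ≠ 0 → 0 < randersTensor (A ξ) (b ξ) η u u)
    (hη : η ≠ 0) (u c : EuclideanSpace ℝ (Fin n))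
    (hc : chernVector (fun ξ => randersNorm (A ξ) (b ξ)) ξ η = c) :
    A ξ u c / √(A ξ η η) - A ξ η u * A ξ η c / √(A ξ η η) ^ 3
      = fderiv ℝ (fun ξ => A ξ η u / √(A ξ η η)) ξ η - fderiv ℝ (fun ξ => √(A ξ η η)) ξ u
        + (fderiv ℝ (fun ξ => b ξ u) ξ η - fderiv ℝ (fun ξ => b ξ η) ξ u) := by
  have hs0 := hs.self_of_nhds
  have hη' := hpos.self_of_nhds η hη
  have hr := Real.sqrt_pos.2 hη'
  have hN := differentiableAt_randersNorm hd hb hη'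
  have hM := differentiableAt_randersMomentum hd hb hη'
  have hN0 : randersNorm (A ξ) (b ξ) η ≠ 0 := by
    intro h0
    have := hconv η hη
    rw [randersTensor_self_left hη', h0, zero_mul] at this
    exact this.false
  have hfN : ∀ w, fderiv ℝ (fun ξ => randersNorm (A ξ) (b ξ) η) ξ w
      = fderiv ℝ (fun ξ => √(A ξ η η)) ξ w + fderiv ℝ (fun ξ => b ξ η) ξ w := fun w =>
    congrArg (· w) (fderiv_fun_add (differentiableAt_sqrt_metric hd hη') (hb η))
  have hfM : ∀ w, fderiv ℝ (fun ξ => randersMomentum (A ξ) (b ξ) η u) ξ w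
      = fderiv ℝ (fun ξ => A ξ η u / √(A ξ η η)) ξ w + fderiv ℝ (fun ξ => b ξ u) ξ w := fun w =>
    congrArg (· w) (fderiv_fun_add (differentiableAt_unit_covector hd hη' u) (hb u))
  have main : ∀ u, randersTensor (A ξ) (b ξ) η u c
      = randersNorm (A ξ) (b ξ) η * fderiv ℝ (fun ξ => randersMomentum (A ξ) (b ξ) η u) ξ η
        + randersMomentum (A ξ) (b ξ) η u * fderiv ℝ (fun ξ => randersNorm (A ξ) (b ξ) η) ξ η
        - randersNorm (A ξ) (b ξ) η * fderiv ℝ (fun ξ => randersNorm (A ξ) (b ξ) η) ξ u := by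
    intro u
    rw [← hc, randersTensor_chernVector hd hb hs hpos hconv hη, fderiv_fun_mul hN (hM u),
      fderiv_fun_pow 2 hN]
    simp
    ring
  -- The case `u = η` of `main`, divided by `F`; it makes the `dF ⊗ dF` contribution cancel below.
  have hℓ : randersMomentum (A ξ) (b ξ) η c
      = fderiv ℝ (fun ξ => randersNorm (A ξ) (b ξ) η) ξ η := by
    have h := main η
    simp only [randersMomentum_self, randersTensor_self_left hη'] at h
    exact mul_left_cancel₀ hN0 (by linarith)
  have hsplit : randersTensor (A ξ) (b ξ) η u c = randersNorm (A ξ) (b ξ) η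
      * (A ξ u c / √(A ξ η η) - A ξ η u * A ξ η c / √(A ξ η η) ^ 3)
      + randersMomentum (A ξ) (b ξ) η u * randersMomentum (A ξ) (b ξ) η c := by
    simp only [randersTensor, randersNorm, randersMomentum]
    field_simp
    ring
  refine mul_left_cancel₀ hN0 ?_
  have h := main u
  rw [hsplit, hℓ, hfM, hfN u] at h
  linarith

/-- The linear part of a Randers metric is a closed form if the geodesics are reversible to second
order, that is, if `Γ^i_jk(ξ, η) η^j η^k` is even in `η`. -/
theorem fderiv_linear_comm
    (hd : ∀ u v, DifferentiableAt ℝ (fun ξ => A ξ u v) ξ)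
    (hb : ∀ u, DifferentiableAt ℝ (fun ξ => b ξ u) ξ)
    (hs : ∀ᶠ ξ' in nhds ξ, ∀ u v, A ξ' u v = A ξ' v u)
    (hpos : ∀ᶠ ξ' in nhds ξ, ∀ η, η ≠ 0 → 0 < A ξ' η η)
    (hconv : ∀ η u, η ≠ 0 → u ≠ 0 → 0 < randersTensor (A ξ) (b ξ) η u u)
    (heven : ∀ η, η ≠ 0 → chernVector (fun ξ => randersNorm (A ξ) (b ξ)) ξ (-η)
      = chernVector (fun ξ => randersNorm (A ξ) (b ξ)) ξ η)
    (u v : EuclideanSpace ℝ (Fin n)) :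
    fderiv ℝ (fun ξ => b ξ u) ξ v = fderiv ℝ (fun ξ => b ξ v) ξ u := by
  rcases eq_or_ne v 0 with rfl | hv
  · simp
  have h1 := covector_chernVector hd hb hs hpos (fun u => hconv v u hv) hv u _ rfl
  have h2 := covector_chernVector hd hb hs hpos (fun u => hconv (-v) u (neg_ne_zero.2 hv))
    (neg_ne_zero.2 hv) u _ (heven v hv)
  simp only [map_neg, LinearMap.neg_apply, neg_neg, neg_mul_neg, neg_div, fderiv_fun_neg,
    neg_apply] at h2
  linarith

end Coordinates

/-! ### Transfer to charts of the manifold, and invariance of the two parts of a Randers metric. -/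

section Charts

variable {n : ℕ} {M : Type*} [TopologicalSpace M] [ChartedSpace (EuclideanSpace ℝ (Fin n)) M]

/-- The coordinate expression of a field of linear forms. -/
noncomputable def formInChart (θ : ∀ x : M, TangentSpace (𝓡 n) x →L[ℝ] ℝ)
    (φ : OpenPartialHomeomorph M (EuclideanSpace ℝ (Fin n))) (ξ : EuclideanSpace ℝ (Fin n)) :
    EuclideanSpace ℝ (Fin n) →L[ℝ] ℝ :=
  (θ (φ.symm ξ)).comp (mfderiv (𝓡 n) (𝓡 n) φ.symm ξ)

lemma mfderiv_chart_symm_injective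
    {φ : OpenPartialHomeomorph M (EuclideanSpace ℝ (Fin n))} {ξ : EuclideanSpace ℝ (Fin n)}
    (hφ : φ ∈ IsManifold.maximalAtlas (𝓡 n) ∞ M) (hξ : ξ ∈ φ.target) :
    Function.Injective (mfderiv (𝓡 n) (𝓡 n) φ.symm ξ) := by
  have h1 : MDifferentiableAt (𝓡 n) (𝓡 n) φ (φ.symm ξ) :=
    (contMDiffAt_of_mem_maximalAtlas hφ (φ.map_target hξ)).mdifferentiableAt (by simp)
  have h2 : MDifferentiableAt (𝓡 n) (𝓡 n) φ.symm ξ :=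
    (contMDiffAt_symm_of_mem_maximalAtlas hφ hξ).mdifferentiableAt (by simp)
  have h3 : mfderiv (𝓡 n) (𝓡 n) (φ ∘ φ.symm) ξ = ContinuousLinearMap.id ℝ _ := by
    rw [← mfderiv_id]
    apply Filter.EventuallyEq.mfderiv_eq
    filter_upwards [φ.open_target.mem_nhds hξ] with ζ hζ
    exact φ.right_inv hζ
  rw [mfderiv_comp ξ h1 h2] at h3
  intro u v huv
  have hu := congrArg (fun T => T u) h3
  have hv := congrArg (fun T => T v) h3
  simp only [ContinuousLinearMap.comp_apply] at hu hv
  rw [huv] at hu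
  exact hu.symm.trans hv

variable [IsManifold (𝓡 n) ∞ M]

/-- The coordinate expression of a Riemannian metric. -/
noncomputable def RiemMetric.inChart (a : RiemMetric n M)
    (φ : OpenPartialHomeomorph M (EuclideanSpace ℝ (Fin n))) (ξ : EuclideanSpace ℝ (Fin n)) :
    EuclideanSpace ℝ (Fin n) →ₗ[ℝ] EuclideanSpace ℝ (Fin n) →ₗ[ℝ] ℝ :=
  LinearMap.mk₂ ℝ (fun u v => a.inner (φ.symm ξ) (mfderiv (𝓡 n) (𝓡 n) φ.symm ξ u)
      (mfderiv (𝓡 n) (𝓡 n) φ.symm ξ v))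
    (fun u u' v => by
      rw [show mfderiv (𝓡 n) (𝓡 n) φ.symm ξ (u + u') = _ from map_add _ u u', map_add]; rfl)
    (fun c u v => by
      rw [show mfderiv (𝓡 n) (𝓡 n) φ.symm ξ (c • u) = _ from map_smul _ c u, map_smul]; rfl)
    (fun u v v' => by
      rw [show mfderiv (𝓡 n) (𝓡 n) φ.symm ξ (v + v') = _ from map_add _ v v', map_add]; rfl)
    (fun c u v => by
      rw [show mfderiv (𝓡 n) (𝓡 n) φ.symm ξ (c • v) = _ from map_smul _ c v, map_smul]; rfl)

variable {a : RiemMetric n M} {X : ∀ x : M, TangentSpace (𝓡 n) x}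
  {φ : OpenPartialHomeomorph M (EuclideanSpace ℝ (Fin n))} {ξ : EuclideanSpace ℝ (Fin n)}

lemma contMDiffAt_inner {N : Type*} {E : Type*} [NormedAddCommGroup E] [NormedSpace ℝ E]
    [TopologicalSpace N] [ChartedSpace E N] {f : N → M} {v w : ∀ x, TangentSpace (𝓡 n) (f x)}
    {x : N}
    (hv : ContMDiffAt 𝓘(ℝ, E) (𝓡 n).tangent ∞ (fun m => (⟨f m, v m⟩ : TangentBundle (𝓡 n) M)) x)
    (hw : ContMDiffAt 𝓘(ℝ, E) (𝓡 n).tangent ∞ (fun m => (⟨f m, w m⟩ : TangentBundle (𝓡 n) M)) x) :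
    ContMDiffAt 𝓘(ℝ, E) 𝓘(ℝ, ℝ) ∞ (fun m => a.inner (f m) (v m) (w m)) x := by
  have hb : ContMDiffAt 𝓘(ℝ, E) (𝓡 n) ∞ f x := by
    simp only [Bundle.contMDiffAt_totalSpace] at hv
    exact hv.1
  have : ContMDiffAt 𝓘(ℝ, E) ((𝓡 n).prod 𝓘(ℝ)) ∞
      (fun m ↦ Bundle.TotalSpace.mk' ℝ (E := Bundle.Trivial M ℝ) (f m)
        (a.inner (f m) (v m) (w m))) x := by
    apply ContMDiffAt.clm_bundle_apply₂ (F₁ := EuclideanSpace ℝ (Fin n))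
      (F₂ := EuclideanSpace ℝ (Fin n))
    · exact ContMDiffAt.comp x a.contMDiff.contMDiffAt hb
    · exact hv
    · exact hw
  simp only [Bundle.contMDiffAt_totalSpace] at this
  exact this.2

/-- The coordinate field is the tangent map of `φ.symm` applied to the constant section `u`. -/
lemma contMDiffAt_chart_symm_vector (hφ : φ ∈ IsManifold.maximalAtlas (𝓡 n) ∞ M)
    (hξ : ξ ∈ φ.target) (u : EuclideanSpace ℝ (Fin n)) :
    ContMDiffAt (𝓡 n) (𝓡 n).tangent ∞ (fun ξ => (⟨φ.symm ξ, mfderiv (𝓡 n) (𝓡 n) φ.symm ξ u⟩ :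
      TangentBundle (𝓡 n) M)) ξ := by
  have h1 := (contMDiffOn_symm_of_mem_maximalAtlas hφ).contMDiffOn_tangentMapWithin (m := ∞)
    (by simp) φ.open_target.uniqueMDiffOn
  have h2 : ContMDiffAt (𝓡 n) (𝓡 n).tangent ∞
      (fun ξ => (⟨ξ, u⟩ : TangentBundle (𝓡 n) (EuclideanSpace ℝ (Fin n)))) ξ :=
    contMDiffAt_vectorSpace_iff_contDiffAt.2 contDiffAt_const
  have h3 := (h1.contMDiffAt (x := (⟨ξ, u⟩ : TangentBundle (𝓡 n) (EuclideanSpace ℝ (Fin n))))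
    ((φ.open_target.preimage
      (FiberBundle.continuous_proj _ _)).mem_nhds hξ)).comp ξ h2
  refine h3.congr_of_eventuallyEq ?_
  filter_upwards [φ.open_target.mem_nhds hξ] with ζ hζ
  simp only [Function.comp_def, tangentMapWithin]
  rw [mfderivWithin_of_isOpen φ.open_target hζ]

lemma RiemMetric.differentiableAt_inChart (hφ : φ ∈ IsManifold.maximalAtlas (𝓡 n) ∞ M)
    (hξ : ξ ∈ φ.target) (u v : EuclideanSpace ℝ (Fin n)) :
    DifferentiableAt ℝ (fun ξ => RiemMetric.inChart a φ ξ u v) ξ := by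
  have := contMDiffAt_inner (a := a) (contMDiffAt_chart_symm_vector hφ hξ u)
    (contMDiffAt_chart_symm_vector hφ hξ v)
  exact this.contDiffAt.differentiableAt (by simp)

lemma differentiableAt_formInChart (hφ : φ ∈ IsManifold.maximalAtlas (𝓡 n) ∞ M)
    (hξ : ξ ∈ φ.target)
    (hX : ContMDiff (𝓡 n) (𝓡 n).tangent ∞ (fun x => (⟨x, X x⟩ : TangentBundle (𝓡 n) M)))
    (u : EuclideanSpace ℝ (Fin n)) :
    DifferentiableAt ℝ (fun ξ => formInChart (fun x => a.inner x (X x)) φ ξ u) ξ := by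
  have := contMDiffAt_inner (a := a)
    (hX.contMDiffAt.comp ξ (contMDiffAt_symm_of_mem_maximalAtlas hφ hξ))
    (contMDiffAt_chart_symm_vector hφ hξ u)
  exact this.contDiffAt.differentiableAt (by simp)

lemma RiemMetric.inChart_pos (hφ : φ ∈ IsManifold.maximalAtlas (𝓡 n) ∞ M) (hξ : ξ ∈ φ.target)
    {η : EuclideanSpace ℝ (Fin n)} (hη : η ≠ 0) : 0 < RiemMetric.inChart a φ ξ η η :=
  a.pos _ _ fun h => hη (mfderiv_chart_symm_injective hφ hξ (h.trans (map_zero _).symm))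

lemma FinslerMetric.IsRanders.inChart_eq {F : FinslerMetric n M} (hF : F.IsRanders a X) :
    F.inChart φ = fun ξ => randersNorm (RiemMetric.inChart a φ ξ)
      (formInChart (fun x => a.inner x (X x)) φ ξ : EuclideanSpace ℝ (Fin n) →ₗ[ℝ] ℝ) := by
  funext ξ η
  exact hF.eq _ _

/-- The linear form of a Randers metric of Berwald type is closed. -/
theorem FinslerMetric.IsRanders.fderiv_formInChart_comm {F : FinslerMetric n M}
    (hF : F.IsRanders a X) (hB : F.IsBerwald) (hφ : φ ∈ IsManifold.maximalAtlas (𝓡 n) ∞ M)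
    (hξ : ξ ∈ φ.target) (u v : EuclideanSpace ℝ (Fin n)) :
    fderiv ℝ (fun ξ => formInChart (fun x => a.inner x (X x)) φ ξ u) ξ v
      = fderiv ℝ (fun ξ => formInChart (fun x => a.inner x (X x)) φ ξ v) ξ u := by
  have hs : ∀ ξ u v, RiemMetric.inChart a φ ξ u v = RiemMetric.inChart a φ ξ v u :=
    fun ξ u v => a.symm _ _ _
  refine fderiv_linear_comm (A := RiemMetric.inChart a φ)
    (b := fun ξ => (formInChart (fun x => a.inner x (X x)) φ ξ : EuclideanSpace ℝ (Fin n) →ₗ[ℝ] ℝ))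
    (fun u v => RiemMetric.differentiableAt_inChart hφ hξ u v)
    (fun u => differentiableAt_formInChart hφ hξ hF.smooth u)
    (Filter.Eventually.of_forall hs) ?_ ?_ ?_ u v
  · filter_upwards [φ.open_target.mem_nhds hξ] with ζ hζ η hη
    exact RiemMetric.inChart_pos hφ hζ hη
  · intro η u hη hu
    have hinj := mfderiv_chart_symm_injective hφ hξ
    -- Strong convexity passes to coordinates because the differential of `φ.symm` is linear and
    -- injective.
    have h := F.convex (φ.symm ξ) (mfderiv (𝓡 n) (𝓡 n) φ.symm ξ η) (mfderiv (𝓡 n) (𝓡 n) φ.symm ξ u)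
      (fun h => hη (hinj (h.trans (map_zero _).symm)))
      (fun h => hu (hinj (h.trans (map_zero _).symm)))
    rw [← fundamentalTensor_randersNorm (hs ξ) (RiemMetric.inChart_pos hφ hξ hη),
      ← congrFun hF.inChart_eq ξ]
    convert h using 1
    simp only [fundamentalTensor, FinslerMetric.inChart]
    congr! 8
    exact ((map_add _ _ _).trans (congrArg₂ _ ((map_add _ _ _).trans
      (congrArg₂ _ rfl (map_smul _ _ _))) (map_smul _ _ _)))
  · intro η hη
    rw [← hF.inChart_eq]
    simp only [chernVector]
    refine Finset.sum_congr rfl fun i _ => ?_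
    congr 1
    refine Finset.sum_congr rfl fun j _ => Finset.sum_congr rfl fun k _ => ?_
    rw [hB φ hφ ξ hξ (-η) η (neg_ne_zero.2 hη) hη i j k]
    simp

/-- A group that leaves a Randers metric invariant leaves its Riemannian metric and its linear form
invariant. -/
theorem FinslerMetric.IsRanders.isInvariant {G : Type*} [Group G] [MulAction G M]
    {F : FinslerMetric n M} (hF : F.IsRanders a X) (hInv : F.IsInvariant G) :
    RiemMetric.IsInvariant a G ∧ ∀ (g : G) (x : M) (v : TangentSpace (𝓡 n) x),
      a.inner (g • x) (X (g • x)) (mfderiv (𝓡 n) (𝓡 n) (fun z : M => g • z) x v)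
        = a.inner x (X x) v := by
  have h : ∀ (g : G) (x : M) (v : TangentSpace (𝓡 n) x),
      a.inner (g • x) (mfderiv (𝓡 n) (𝓡 n) (fun z : M => g • z) x v)
          (mfderiv (𝓡 n) (𝓡 n) (fun z : M => g • z) x v) = a.inner x v v ∧
      a.inner (g • x) (X (g • x)) (mfderiv (𝓡 n) (𝓡 n) (fun z : M => g • z) x v)
        = a.inner x (X x) v := by
    intro g x v
    have h1 := hInv g x v
    -- Adding and subtracting the equations for `v` and `-v` separates `α` from `β`.
    have h2 := hInv g x (-v)
    simp only [hF.eq, map_neg, neg_apply, neg_neg] at h1 h2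
    have h0 : ∀ x (v : TangentSpace (𝓡 n) x), 0 ≤ a.inner x v v := by
      intro x v
      rcases eq_or_ne v 0 with rfl | hv
      · simp
      · exact (a.pos x v hv).le
    exact ⟨(Real.sqrt_inj (h0 _ _) (h0 _ _)).1 (by linarith), by linarith⟩
  refine ⟨fun g x u v => ?_, fun g x v => (h g x v).2⟩
  have h1 := (h g x (u + v)).1
  simp only [map_add, add_apply, (h g x u).1, (h g x v).1, a.symm x v u] at h1
  rw [a.symm (g • x) (mfderiv (𝓡 n) (𝓡 n) (fun z : M => g • z) x v)] at h1
  linarith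

end Charts

/-! ### Closed invariant forms vanish on Lie brackets. -/

/-- If a closed form `b` pulled back by `f` is constant on the vector fields `V` and `W`, then it
vanishes on their Lie bracket. -/
theorem closed_form_lieBracket {E E' : Type*} [NormedAddCommGroup E] [NormedSpace ℝ E]
    [NormedAddCommGroup E'] [NormedSpace ℝ E'] {b : E' → E' →L[ℝ] ℝ} {f : E → E'} {V W : E → E}
    {x : E} (hf : ContDiffAt ℝ 2 f x) (hb : DifferentiableAt ℝ b (f x))
    (hclosed : ∀ u v, fderiv ℝ b (f x) u v = fderiv ℝ b (f x) v u)
    (hV : DifferentiableAt ℝ V x) (hW : DifferentiableAt ℝ W x) {c c' : ℝ}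
    (hcV : ∀ᶠ z in nhds x, b (f z) (fderiv ℝ f z (V z)) = c)
    (hcW : ∀ᶠ z in nhds x, b (f z) (fderiv ℝ f z (W z)) = c') :
    b (f x) (fderiv ℝ f x (VectorField.lieBracket ℝ V W x)) = 0 := by
  have hfd : DifferentiableAt ℝ f x := hf.differentiableAt (by simp)
  have hf' : DifferentiableAt ℝ (fderiv ℝ f) x :=
    (hf.fderiv_right (m := 1) (by norm_num)).differentiableAt (by simp)
  have hsymm : IsSymmSndFDerivAt ℝ f x := hf.isSymmSndFDerivAt (by simp)
  -- The derivative in direction `w` of the constant function `z ↦ b(f z)(Df_z V_z)`. Taking it for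
  -- `V` along `W` and for `W` along `V` and subtracting, closedness cancels the `Db` terms and
  -- symmetry of `D²f` the second-order ones; the bracket is left.
  have key : ∀ {V : E → E} {c : ℝ}, DifferentiableAt ℝ V x →
      (∀ᶠ z in nhds x, b (f z) (fderiv ℝ f z (V z)) = c) → ∀ w,
      fderiv ℝ b (f x) (fderiv ℝ f x w) (fderiv ℝ f x (V x))
        + b (f x) (fderiv ℝ (fderiv ℝ f) x w (V x) + fderiv ℝ f x (fderiv ℝ V x w)) = 0 := by
    intro V c hV hcV w
    have h1 := (hb.hasFDerivAt.comp x hfd.hasFDerivAt).clm_apply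
      (hf'.hasFDerivAt.clm_apply hV.hasFDerivAt)
    have h2 := h1.unique ((hasFDerivAt_const c x).congr_of_eventuallyEq hcV)
    have h3 := congrArg (fun T => T w) h2
    simp at h3
    simp
    linarith
  have h1 := key hV hcV (W x)
  have h2 := key hW hcW (V x)
  rw [hclosed] at h1
  have h3 := hsymm (V x) (W x)
  rw [VectorField.lieBracket]
  simp only [map_add, map_sub] at h1 h2 ⊢
  rw [h3] at h2
  linarith

section Homogeneous

variable {d n : ℕ}
  {G : Type*} [TopologicalSpace G] [ChartedSpace (EuclideanSpace ℝ (Fin d)) G] [Group G]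
  {M : Type*} [TopologicalSpace M] [ChartedSpace (EuclideanSpace ℝ (Fin n)) M] [MulAction G M]

/-- Differentiate `(g * h) • p = g • (h • p)` in `h` at `1`. Together with invariance of a form,
this makes its pullback to `G` constant on left-invariant fields. -/
lemma mfderiv_orbit_mulInvariantVectorField [LieGroup (𝓡 d) ∞ G]
    [ContMDiffSMul (𝓡 d) (𝓡 n) ∞ G M] (p : M) (x : GroupLieAlgebra (𝓡 d) G) (g : G) :
    mfderiv (𝓡 d) (𝓡 n) (fun g : G => g • p) g (mulInvariantVectorField x g)
      = mfderiv (𝓡 n) (𝓡 n) (fun z : M => g • z) p (dπ (d := d) (n := n) G p x) := by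
  have hπ : ContMDiff (𝓡 d) (𝓡 n) ∞ (fun g : G => g • p) := contMDiff_id.smul contMDiff_const
  have hg : ContMDiff (𝓡 n) (𝓡 n) ∞ (fun z : M => g • z) :=
    ContMDiffSMul.contMDiff_const_smul (I := 𝓡 d) g
  have hm : ContMDiff (𝓡 d) (𝓡 d) ∞ (fun h : G => g * h) := contMDiff_mul_left
  have h1 := mfderiv_comp (I' := 𝓡 d) (1 : G) (hπ.mdifferentiableAt (by simp))
    (hm.mdifferentiableAt (x := 1) (by simp))
  have h2 := mfderiv_comp (I' := 𝓡 n) (1 : G) (hg.mdifferentiableAt (by simp))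
    (hπ.mdifferentiableAt (x := 1) (by simp))
  have h3 : (fun g : G => g • p) ∘ (fun h : G => g * h)
      = (fun z : M => g • z) ∘ (fun g : G => g • p) := by
    funext h
    exact mul_smul g h p
  rw [h3] at h1
  have h4 := congrArg (fun T => T x) (h1.symm.trans h2)
  simp only [ContinuousLinearMap.comp_apply] at h4
  -- The base points `g * 1` and `1 • p` equal `g` and `p` only propositionally, so the vectors are
  -- compared in the model space.
  have e1 : ∀ g', g' = g → ∀ w : EuclideanSpace ℝ (Fin d),
      (mfderiv (𝓡 d) (𝓡 n) (fun g : G => g • p) g' w : EuclideanSpace ℝ (Fin n))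
        = mfderiv (𝓡 d) (𝓡 n) (fun g : G => g • p) g w := by
    rintro _ rfl _; rfl
  have e2 : ∀ q, q = p → ∀ w : EuclideanSpace ℝ (Fin n),
      (mfderiv (𝓡 n) (𝓡 n) (fun z : M => g • z) q w : EuclideanSpace ℝ (Fin n))
        = mfderiv (𝓡 n) (𝓡 n) (fun z : M => g • z) p w := by
    rintro _ rfl _; rfl
  exact (e1 _ (mul_one g) _).symm.trans (h4.trans (e2 _ (one_smul G p) _))

end Homogeneous

section Homogeneous

variable {d n : ℕ}
  {G : Type*} [TopologicalSpace G] [ChartedSpace (EuclideanSpace ℝ (Fin d)) G] [Group G]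
  {M : Type*} [TopologicalSpace M] [ChartedSpace (EuclideanSpace ℝ (Fin n)) M] [MulAction G M]

lemma differentiableAt_clm_of_apply {E : Type*} [NormedAddCommGroup E] [NormedSpace ℝ E]
    {b : E → EuclideanSpace ℝ (Fin n) →L[ℝ] ℝ} {x : E}
    (h : ∀ u, DifferentiableAt ℝ (fun x => b x u) x) : DifferentiableAt ℝ b x := by
  have : b = fun x => ∑ i, b x (coordVec i) •
      (EuclideanSpace.proj i : EuclideanSpace ℝ (Fin n) →L[ℝ] ℝ) := by
    funext x
    ext u
    conv_lhs => rw [← sum_smul_coordVec u]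
    simp [mul_comm]
  rw [this]
  exact DifferentiableAt.fun_sum fun i _ => (h _).smul_const _

/-- The coordinate expression of a form recovers the form. -/
lemma formInChart_mfderiv (θ : ∀ x : M, TangentSpace (𝓡 n) x →L[ℝ] ℝ)
    {φ : OpenPartialHomeomorph M (EuclideanSpace ℝ (Fin n))}
    (hφ : φ ∈ IsManifold.maximalAtlas (𝓡 n) ∞ M) {q : M} (hq : q ∈ φ.source)
    (v : TangentSpace (𝓡 n) q) :
    formInChart θ φ (φ q) (mfderiv (𝓡 n) (𝓡 n) φ q v) = θ q v := by
  have h1 : MDifferentiableAt (𝓡 n) (𝓡 n) φ q :=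
    (contMDiffAt_of_mem_maximalAtlas hφ hq).mdifferentiableAt (by simp)
  have h2 : MDifferentiableAt (𝓡 n) (𝓡 n) φ.symm (φ q) :=
    (contMDiffAt_symm_of_mem_maximalAtlas hφ (φ.map_source hq)).mdifferentiableAt (by simp)
  have h3 : mfderiv (𝓡 n) (𝓡 n) (φ.symm ∘ φ) q = ContinuousLinearMap.id ℝ _ := by
    rw [← mfderiv_id]
    apply Filter.EventuallyEq.mfderiv_eq
    filter_upwards [φ.open_source.mem_nhds hq] with ζ hζ
    exact φ.left_inv hζ
  rw [mfderiv_comp q h2 h1] at h3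
  have h4 := congrArg (fun T => T v) h3
  have h5 : ∀ q', q' = q → ∀ w : EuclideanSpace ℝ (Fin n), (θ q' : EuclideanSpace ℝ (Fin n) →L[ℝ] ℝ) w
      = (θ q : EuclideanSpace ℝ (Fin n) →L[ℝ] ℝ) w := by
    rintro _ rfl _; rfl
  exact (h5 _ (φ.left_inv hq) _).trans (congrArg (θ q) h4)

/-- This is `closed_form_lieBracket` applied to the orbit map read in the chart of `G` at `1` and in
`φ`, with the left-invariant fields of `x` and `y`. -/
theorem closed_invariant_form_bracket [LieGroup (𝓡 d) ∞ G]
    [ContMDiffSMul (𝓡 d) (𝓡 n) ∞ G M] (θ : ∀ x : M, TangentSpace (𝓡 n) x →L[ℝ] ℝ)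
    (hinv : ∀ (g : G) (x : M) (v : TangentSpace (𝓡 n) x),
      θ (g • x) (mfderiv (𝓡 n) (𝓡 n) (fun z : M => g • z) x v) = θ x v)
    {φ : OpenPartialHomeomorph M (EuclideanSpace ℝ (Fin n))}
    (hφ : φ ∈ IsManifold.maximalAtlas (𝓡 n) ∞ M) {p : M} (hp : p ∈ φ.source)
    (hd : ∀ u, DifferentiableAt ℝ (fun ξ => formInChart θ φ ξ u) (φ p))
    (hclosed : ∀ u v, fderiv ℝ (fun ξ => formInChart θ φ ξ u) (φ p) v
      = fderiv ℝ (fun ξ => formInChart θ φ ξ v) (φ p) u)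
    (x y : GroupLieAlgebra (𝓡 d) G) :
    θ p (dπ (d := d) (n := n) G p ⁅x, y⁆) = 0 := by
  have : LieGroup (𝓡 d) (minSmoothness ℝ 3) G := by
    rw [minSmoothness_of_isRCLikeNormedField]
    exact LieGroup.of_le (n := ∞) ENat.LEInfty.out
  have : IsManifold (𝓡 d) ∞ G := (inferInstance : LieGroup (𝓡 d) ∞ G).toIsManifold
  have : IsManifold (𝓡 d) 1 G := .of_le (n := ∞) (by simp)
  have : IsManifold (𝓡 d) 2 G := .of_le (n := ∞) ENat.LEInfty.out
  set e := extChartAt (𝓡 d) (1 : G)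
  set f : EuclideanSpace ℝ (Fin d) → EuclideanSpace ℝ (Fin n) := fun ζ => φ (e.symm ζ • p)
  have hrange : Set.range (𝓡 d) = Set.univ := ModelWithCorners.range_eq_univ _
  have he1 : e.symm (e 1) = 1 := extChartAt_to_inv (I := 𝓡 d) (1 : G)
  have hf1 : f (e 1) = φ p := by simp only [f, he1, one_smul]
  have hπ : ContMDiff (𝓡 d) (𝓡 n) ∞ (fun g : G => g • p) := contMDiff_id.smul contMDiff_const
  have hsymm : ∀ ζ ∈ e.target, ContMDiffAt (𝓡 d) (𝓡 d) ∞ e.symm ζ := fun ζ hζ =>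
    (contMDiffOn_extChartAt_symm (1 : G)).contMDiffAt
      ((isOpen_extChartAt_target (I := 𝓡 d) (1 : G)).mem_nhds hζ)
  have hφd : ∀ q ∈ φ.source, ContMDiffAt (𝓡 n) (𝓡 n) ∞ φ q := fun q hq =>
    contMDiffAt_of_mem_maximalAtlas hφ hq
  have htarget : e.target ∈ nhds (e 1) := extChartAt_target_mem_nhds (I := 𝓡 d) (1 : G)
  have h1t : e 1 ∈ e.target := mem_extChartAt_target (I := 𝓡 d) (1 : G)
  have hsource : ∀ᶠ ζ in nhds (e 1), e.symm ζ • p ∈ φ.source := by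
    have hc : ContinuousAt (fun ζ => e.symm ζ • p) (e 1) :=
      ContinuousAt.comp (g := fun g : G => g • p) hπ.continuous.continuousAt
        (hsymm _ h1t).continuousAt
    exact hc.eventually_mem (φ.open_source.mem_nhds (by simpa only [he1, one_smul] using hp))
  have hfderiv : ∀ ζ ∈ e.target, e.symm ζ • p ∈ φ.source → ∀ w : EuclideanSpace ℝ (Fin d),
      formInChart θ φ (f ζ) (fderiv ℝ f ζ w) = θ (e.symm ζ • p)
        (mfderiv (𝓡 d) (𝓡 n) (fun g : G => g • p) (e.symm ζ) (mfderiv (𝓡 d) (𝓡 d) e.symm ζ w)) := by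
    intro ζ hζ hs w
    have h1 := (hsymm ζ hζ).mdifferentiableAt (by simp)
    have h2 := hπ.mdifferentiableAt (x := e.symm ζ) (by simp)
    have h3 := (hφd _ hs).mdifferentiableAt (by simp)
    have h4 : mfderiv (𝓡 d) (𝓡 n) f ζ = _ := mfderiv_comp ζ (g := φ)
      (f := (fun g : G => g • p) ∘ e.symm) h3 (h2.comp ζ h1)
    rw [mfderiv_comp ζ h2 h1] at h4
    rw [← mfderiv_eq_fderiv]
    rw [← formInChart_mfderiv θ hφ hs]
    exact congrArg (fun T => formInChart θ φ (f ζ) (T w)) h4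
  -- The left-invariant field of `x` in the chart at `1`.
  let pull : GroupLieAlgebra (𝓡 d) G → EuclideanSpace ℝ (Fin d) → EuclideanSpace ℝ (Fin d) :=
    fun x => VectorField.mpullbackWithin (𝓡 d) (𝓡 d) e.symm (mulInvariantVectorField x)
      (Set.range (𝓡 d))
  have hwithin : ∀ ζ, mfderivWithin (𝓡 d) (𝓡 d) e.symm (Set.range (𝓡 d)) ζ
      = mfderiv (𝓡 d) (𝓡 d) e.symm ζ := fun ζ => by rw [hrange, mfderivWithin_univ]
  have hconst : ∀ x : GroupLieAlgebra (𝓡 d) G, ∀ᶠ ζ in nhds (e 1),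
      formInChart θ φ (f ζ) (fderiv ℝ f ζ (pull x ζ)) = θ p (dπ (d := d) (n := n) G p x) := by
    intro x
    filter_upwards [htarget, hsource] with ζ hζ hs
    have hpull : mfderiv (𝓡 d) (𝓡 d) e.symm ζ (pull x ζ)
        = mulInvariantVectorField x (e.symm ζ) := by
      rw [← hwithin]
      exact (isInvertible_mfderivWithin_extChartAt_symm (I := 𝓡 d) hζ).self_apply_inverse _
    rw [hfderiv ζ hζ hs, hpull, mfderiv_orbit_mulInvariantVectorField, hinv]
  have hdiff : ∀ x : GroupLieAlgebra (𝓡 d) G, DifferentiableAt ℝ (pull x) (e 1) := by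
    intro x
    have h := (mdifferentiableAt_mulInvariantVectorField (I := 𝓡 d) (G := G) x (g := 1))
    rw [← mdifferentiableWithinAt_univ] at h
    have h' := h.differentiableWithinAt_mpullbackWithin_vectorField
    exact h'.differentiableAt (by rw [Set.preimage_univ, Set.univ_inter, hrange]; exact Filter.univ_mem)
  have hfs : ContDiffAt ℝ 2 f (e 1) := by
    have h : ContMDiffAt (𝓡 d) (𝓡 n) ∞ f (e 1) :=
      ContMDiffAt.comp (e 1) (hφd _ hsource.self_of_nhds)
        (ContMDiffAt.comp (e 1) hπ.contMDiffAt (hsymm _ h1t))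
    exact h.contDiffAt.of_le ENat.LEInfty.out
  have hb := differentiableAt_clm_of_apply hd
  have hfb : ∀ u v, fderiv ℝ (formInChart θ φ) (φ p) u v
      = fderiv ℝ (fun ξ => formInChart θ φ ξ v) (φ p) u := by
    intro u v
    rw [fderiv_clm_apply hb (differentiableAt_const v)]
    simp
  have key := closed_form_lieBracket (b := formInChart θ φ) hfs (hf1 ▸ hb)
    (fun u v => by rw [hf1, hfb, hfb, hclosed]) (hdiff x) (hdiff y) (hconst x) (hconst y)
  rw [hfderiv _ h1t hsource.self_of_nhds] at key
  have hbase : ∀ q, q = p → ∀ w : EuclideanSpace ℝ (Fin n),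
      (θ q : EuclideanSpace ℝ (Fin n) →L[ℝ] ℝ) w = (θ p : EuclideanSpace ℝ (Fin n) →L[ℝ] ℝ) w := by
    rintro _ rfl _; rfl
  have horbit : ∀ g : G, g = 1 → ∀ w : EuclideanSpace ℝ (Fin d),
      θ (g • p) (mfderiv (𝓡 d) (𝓡 n) (fun g : G => g • p) g w)
        = θ p (dπ (d := d) (n := n) G p w) := by
    rintro _ rfl w
    exact hbase _ (one_smul G p) _
  refine Eq.trans ?_ ((horbit _ he1 _).symm.trans key)
  have hid := mfderivWithin_extChartAt_symm_comp_mfderiv_extChartAt' (I := 𝓡 d)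
    (mem_extChartAt_source (I := 𝓡 d) (1 : G))
  rw [mfderiv_extChartAt_self, hwithin] at hid
  -- The Lie algebra bracket is the bracket of left-invariant fields at `1`, computed in this very
  -- chart, whose differential at its centre is the identity.
  have hbracket : (⁅x, y⁆ : GroupLieAlgebra (𝓡 d) G)
      = VectorField.lieBracket ℝ (pull x) (pull y) (e 1) := by
    have hinverse : ∀ T : EuclideanSpace ℝ (Fin d) →L[ℝ] EuclideanSpace ℝ (Fin d),
        T = ContinuousLinearMap.id ℝ _ → ∀ w, T.inverse w = w := by
      rintro _ rfl w
      rw [ContinuousLinearMap.inverse_id]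
      rfl
    refine Eq.trans ?_ (hinverse _ (mfderiv_extChartAt_self (I := 𝓡 d) (x := (1 : G))) _)
    rw [← VectorField.lieBracketWithin_univ, ← Set.univ_inter Set.univ]
    nth_rw 2 [← hrange]
    rw [← Set.preimage_univ (f := e.symm)]
    exact VectorField.mlieBracketWithin_apply
  rw [hbracket]
  exact congrArg (fun T : EuclideanSpace ℝ (Fin d) →L[ℝ] EuclideanSpace ℝ (Fin d) =>
    θ p (dπ (d := d) (n := n) G p (T (VectorField.lieBracket ℝ (pull x) (pull y) (e 1))))) hid.symm

end Homogeneous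
-- Natural reductivity on a reductive complement.
section Homogeneous

variable {d n : ℕ}
  {G : Type*} [TopologicalSpace G] [ChartedSpace (EuclideanSpace ℝ (Fin d)) G] [Group G]
  {M : Type*} [TopologicalSpace M] [ChartedSpace (EuclideanSpace ℝ (Fin n)) M] [MulAction G M]
  {p : M} {m : Submodule ℝ (GroupLieAlgebra (𝓡 d) G)}

/-- The discarded component lies in `𝔥`, the kernel of `dπ`. -/
lemma IsReductiveDecomposition.dπ_bracket (hm : IsReductiveDecomposition (n := n) p m) (x u : m) :
    dπ (d := d) (n := n) G p (hm.bracket x u)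
      = dπ (d := d) (n := n) G p ⁅(x : GroupLieAlgebra (𝓡 d) G), (u : GroupLieAlgebra (𝓡 d) G)⁆ := by
  have h : ⁅(x : GroupLieAlgebra (𝓡 d) G), (u : GroupLieAlgebra (𝓡 d) G)⁆ - (hm.bracket x u : m)
      ∈ isotropyAlgebra (d := d) (n := n) G p := by
    rw [← Submodule.projectionOnto_apply_eq_zero_iff hm.isCompl, map_sub,
      Submodule.projectionOnto_apply_left]
    exact sub_self _
  have h' : dπ (d := d) (n := n) G p _ = 0 := h
  rw [map_sub, sub_eq_zero] at h'
  exact h'.symm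

lemma IsReductiveDecomposition.dπ_ne_zero (hm : IsReductiveDecomposition (n := n) p m) {y : m}
    (hy : y ≠ 0) : dπ (d := d) (n := n) G p y ≠ 0 := fun h =>
  hy (Subtype.ext ((Submodule.mem_bot ℝ).1 (hm.isCompl.disjoint.le_bot ⟨y.2, h⟩)))

/-- The endomorphism `[x, ·]_𝔪` of `𝔪`. -/
noncomputable def IsReductiveDecomposition.bracketLinear [LieGroup (𝓡 d) (minSmoothness ℝ 3) G]
    (hm : IsReductiveDecomposition (n := n) p m) (x : m) : m →ₗ[ℝ] m :=
  m.projectionOnto (isotropyAlgebra (d := d) (n := n) G p) hm.isCompl ∘ₗ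
    (LieAlgebra.ad ℝ (GroupLieAlgebra (𝓡 d) G) (x : GroupLieAlgebra (𝓡 d) G)) ∘ₗ m.subtype

variable [IsManifold (𝓡 n) ∞ M] {F : FinslerMetric n M} {a : RiemMetric n M}
  {X : ∀ x : M, TangentSpace (𝓡 n) x}

/-- The inner product induced on a complement of the isotropy algebra, as a bilinear form. -/
noncomputable def RiemMetric.bilinOnComplement (a : RiemMetric n M) (p : M)
    (m : Submodule ℝ (GroupLieAlgebra (𝓡 d) G)) : m →ₗ[ℝ] m →ₗ[ℝ] ℝ :=
  LinearMap.mk₂ ℝ (RiemMetric.onComplement (n := n) a p m)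
    (fun u u' v => by simp [RiemMetric.onComplement])
    (fun c u v => by simp [RiemMetric.onComplement])
    (fun u v v' => by simp [RiemMetric.onComplement])
    (fun c u v => by simp [RiemMetric.onComplement])

lemma FinslerMetric.IsRanders.onComplement_eq (hF : F.IsRanders a X) :
    F.onComplement p m = randersNorm (RiemMetric.bilinOnComplement a p m)
      ((a.inner p (X p)).toLinearMap ∘ₗ (dπ (d := d) (n := n) G p).toLinearMap ∘ₗ m.subtype) := by
  funext y
  exact hF.eq _ _

/-- A zero of `F` at `y` spreads along the ray through `y`, forcing `g_y(y, y) = 0` against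
convexity. Homogeneity covers only nonnegative factors, which suffices near `s = t = 0`. -/
lemma FinslerMetric.toFun_ne_zero (F : FinslerMetric n M) {x : M} {y : TangentSpace (𝓡 n) x}
    (hy : y ≠ 0) : F.toFun x y ≠ 0 := by
  intro h0
  have h : ∀ s t : ℝ, 0 ≤ 1 + s + t → F.toFun x (y + s • y + t • y) = 0 := by
    intro s t hst
    rw [show y + s • y + t • y = (1 + s + t) • y by module, F.homogeneous x _ _ hst, h0, mul_zero]
  have hder : (fun s : ℝ => deriv (fun t : ℝ => F.toFun x (y + s • y + t • y) ^ 2) 0)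
      =ᶠ[nhds 0] fun _ => (0 : ℝ) := by
    filter_upwards [lt_mem_nhds (show (-1 : ℝ) < 0 by norm_num)] with s hs
    have : (fun t : ℝ => F.toFun x (y + s • y + t • y) ^ 2) =ᶠ[nhds 0] fun _ => (0 : ℝ) := by
      filter_upwards [lt_mem_nhds (show -(1 + s) < 0 by linarith)] with t ht
      rw [h s t (by linarith)]
      norm_num
    rw [this.deriv_eq, deriv_const]
  have := F.convex x y y hy hy
  rw [fundamentalTensor, hder.deriv_eq, deriv_const, mul_zero] at this
  exact this.false

theorem FinslerMetric.IsRanders.naturallyReductive_condition_iff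
    [LieGroup (𝓡 d) (minSmoothness ℝ 3) G]
    (hF : F.IsRanders a X) (hm : IsReductiveDecomposition (n := n) p m) (x : m) :
    (∀ y u v : m, y ≠ 0 →
      fundamentalTensor (F.onComplement p m) y (hm.bracket x u) v
        + fundamentalTensor (F.onComplement p m) y u (hm.bracket x v)
        + 2 * cartanTensor (F.onComplement p m) y (hm.bracket x y) u v = 0) ↔
    (∀ y z : m, RiemMetric.onComplement a p m (hm.bracket x y) z
        + RiemMetric.onComplement a p m y (hm.bracket x z) = 0) ∧
      ∀ y : m, a.inner p (X p) (dπ (d := d) (n := n) G p (hm.bracket x y)) = 0 := by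
  rw [hF.onComplement_eq]
  refine forall_fundamentalTensor_randersNorm_iff (A := RiemMetric.bilinOnComplement a p m)
    (fun u v => a.symm _ _ _) (fun y hy => a.pos _ _ (hm.dπ_ne_zero hy)) (fun y hy => ?_)
    (hm.bracketLinear x)
  rw [← hF.onComplement_eq]
  exact F.toFun_ne_zero (hm.dπ_ne_zero hy)

/-- The linear form of an invariant Randers metric of Berwald type vanishes on brackets. -/
theorem FinslerMetric.IsRanders.inner_dπ_bracket [LieGroup (𝓡 d) ∞ G]
    [ContMDiffSMul (𝓡 d) (𝓡 n) ∞ G M] (hF : F.IsRanders a X) (hB : F.IsBerwald)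
    (hX : ∀ (g : G) (x : M) (v : TangentSpace (𝓡 n) x),
      a.inner (g • x) (X (g • x)) (mfderiv (𝓡 n) (𝓡 n) (fun z : M => g • z) x v)
        = a.inner x (X x) v) (p : M) (x y : GroupLieAlgebra (𝓡 d) G) :
    a.inner p (X p) (dπ (d := d) (n := n) G p ⁅x, y⁆) = 0 := by
  have hφ := IsManifold.chart_mem_maximalAtlas (I := 𝓡 n) (n := ∞) p
  have hp := mem_chart_source (EuclideanSpace ℝ (Fin n)) p
  have hξ := (chartAt (EuclideanSpace ℝ (Fin n)) p).map_source hp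
  let θ : ∀ x : M, TangentSpace (𝓡 n) x →L[ℝ] ℝ := fun x => a.inner x (X x)
  have hd : ∀ u, DifferentiableAt ℝ
      (fun ξ => formInChart θ (chartAt (EuclideanSpace ℝ (Fin n)) p) ξ u)
      (chartAt (EuclideanSpace ℝ (Fin n)) p p) := differentiableAt_formInChart hφ hξ hF.smooth
  have hc := hF.fderiv_formInChart_comm hB hφ hξ
  have key := closed_invariant_form_bracket θ hX hφ hp hd hc x y
  exact key

end Homogeneous

end HomFinsler

theorem theorem4p3 {d n : ℕ}
    {G : Type*} [TopologicalSpace G] [ChartedSpace (EuclideanSpace ℝ (Fin d)) G] [Group G]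
    [LieGroup (𝓡 d) ∞ G] [SecondCountableTopology G]
    {M : Type*} [TopologicalSpace M] [T2Space M] [ChartedSpace (EuclideanSpace ℝ (Fin n)) M]
    [IsManifold (𝓡 n) ∞ M]
    [MulAction G M] [ContMDiffSMul (𝓡 d) (𝓡 n) ∞ G M] [MulAction.IsPretransitive G M]
    (F : HomFinsler.FinslerMetric n M) (a : HomFinsler.RiemMetric n M)
    (X : ∀ x : M, TangentSpace (𝓡 n) x)
    (hRanders : F.IsRanders a X) (hInv : F.IsInvariant G) (hBerwald : F.IsBerwald) (p : M) :
    F.IsNaturallyReductive d G p ↔ HomFinsler.RiemMetric.IsNaturallyReductive a d G p := by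
  have : LieGroup (𝓡 d) (minSmoothness ℝ 3) G := by
    rw [minSmoothness_of_isRCLikeNormedField]
    exact LieGroup.of_le (n := ∞) ENat.LEInfty.out
  obtain ⟨haInv, hXInv⟩ := hRanders.isInvariant hInv
  constructor
  · rintro ⟨-, m, hm, h⟩
    exact ⟨haInv, m, hm, fun x =>
      ((hRanders.naturallyReductive_condition_iff hm x).1 fun y => h y x).1⟩
  · rintro ⟨-, m, hm, h⟩
    -- The complement that works for `ã` also works for `F`; only the vanishing of `β` on `[x, y]_𝔪`
    -- is left.
    refine ⟨hInv, m, hm, fun y x =>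
      (hRanders.naturallyReductive_condition_iff hm x).2 ⟨h x, fun y => ?_⟩ y⟩
    rw [hm.dπ_bracket]
    exact hRanders.inner_dπ_bracket hBerwald hXInv p _ _
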